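/- Let $q>2$ be a prime power and regard $V=\mathbb{F}_{q^3}^3$ both as a 3-dimensional space over $\mathbb{F}_{q^3}$, giving $\mathrm{PG}(2,q^3)$, and as a 9-dimensional space over $\mathbb{F}_q$, giving $\mathrm{PG}(8,q)$ (field reduction). Each point of $\mathrm{PG}(2,q^3)$ is a plane of $\mathrm{PG}(8,q)$ and each line of $\mathrm{PG}(2,q^3)$ is a 5-space of $\mathrm{PG}(8,q)$. Let $\phi$ be a collineation of $\mathrm{PG}(2,q^3)$ of order 3 that fixes an $\mathbb{F}_q$-plane (the set of points with coordinates in $\mathbb{F}_q$ with respect to some basis) pointwise, and let $\sigma$ be a projectivity of $\mathrm{PG}(8,q)$ that is induced by $\phi$, that is, $\sigma$ comes from an $\mathbb{F}_q$-linear automorphism of $V$ that maps every $\mathbb{F}_{q^3}$-subspace $X$ to $X^\phi$. A point of $\mathrm{PG}(2,q^3)$ has Type I if it is fixed by $\phi$, and Type II if its $\phi$-orbit consists of three collinear points; the corresponding planes of $\mathrm{PG}(8,q)$ are the $\mathbb{S}_{\mathrm I}$-planes and $\mathbb{S}_{\mathrm{II}}$-planes. An $\mathbb{H}_{\mathrm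 I}$-5-space is a 5-space of $\mathrm{PG}(8,q)$ that corresponds to a line of $\mathrm{PG}(2,q^3)$ fixed by $\phi$. A $\mathrm{I}_:$-point (respectively $\mathrm{II}_:$-point) is a non-fixed point $P$ of $\mathrm{PG}(8,q)$ that lies on an $\mathbb{S}_{\mathrm I}$-plane (respectively $\mathbb{S}_{\mathrm{II}}$-plane) and for which $P,P^\sigma,P^{\sigma^2}$ are collinear. A line fixed by $\sigma$ is a ptwise-fixed line if all its points are fixed. It is a fixed-I-line if it lies in an $\mathbb{S}_{\mathrm I}$-plane, is not fixed pointwise, and all its non-fixed points are $\mathrm{I}_:$-points. It is a fixed-II-line if it lies in an $\mathbb{H}_{\mathrm I}$-5-space, is not fixed pointwise, and all its non-fixed points are $\mathrm{II}_:$-points. A hwise-fixed-5-space is a 5-space of $\mathrm{PG}(8,q)$ such that every hyperplane containing it is fixed by $\sigma$. In $\mathrm{PG}(3,q)$, a linear congruence is the set of all lines whose Plücker coordinates satisfy two linearly independent linear equations. It is elliptic if it is a regular line spread (a set of lines partitioning the points, containing with any three of its lines the regulus through them). It is parabolic with axis $\ell$ if it consists of the line $\ell$ and $q^2+q$ further lines,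 each of which meets $\ell$, any two of which are disjoint or meet in a point of $\ell$, and which contain a regulus. It is hyperbolic with axes $\ell_1,\ell_2$ if $\ell_1,\ell_2$ are disjoint lines and it is the set of all lines meeting both $\ell_1$ and $\ell_2$. **Theorem 15.** Let $\Sigma_3$ be the intersection of a hwise-fixed-5-space and an $\mathbb{H}_{\mathrm I}$-5-space, and let $\mathcal F$ be the set of all fixed-I-lines and fixed-II-lines contained in $\Sigma_3$. Then $\Sigma_3$ is a 3-space, and: 1. if $q\equiv -1\pmod 3$, then $\mathcal F$ is an elliptic linear congruence of $\Sigma_3$; 2. if $q\equiv 0\pmod 3$, then $\Sigma_3$ contains a unique ptwise-fixed line $\ell$, and $\mathcal F\cup\{\ell\}$ is a parabolic linear congruence of $\Sigma_3$ with axis $\ell$; 3. if $q\equiv 1\pmod 3$, then $\Sigma_3$ contains exactly two ptwise-fixed lines, and $\mathcal F$ is a hyperbolic linear congruence of $\Sigma_3$ whose axes are these two lines. -/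

import Mathlib

/-! ### Lines, reguli and linear congruences in the projective space of an `F`-vector space `U`

A (projective) subspace is a vector subspace; a point has vector dimension `1`, a line `2`,
a plane `3`, and so on. -/

section Congruences

variable {F U : Type*} [Field F] [AddCommGroup U] [Module F U]

/-- `P` is a point of the projective space of `U`. -/
def IsPt (P : Submodule F U) : Prop := Module.finrank F P = 1

/-- `ℓ` is a line of the projective space of `U`. -/
def IsLn (ℓ : Submodule F U) : Prop := Module.finrank F ℓ = 2

/-- Two subspaces meet (in at least one point). -/
def Meets (ℓ m : Submodule F U) : Prop := ℓ ⊓ m ≠ ⊥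

/-- The set of all lines that meet each of `a`, `b`, `c`. -/
def transversals (a b c : Submodule F U) : Set (Submodule F U) :=
  {t | IsLn t ∧ Meets t a ∧ Meets t b ∧ Meets t c}

/-- A regulus of a three-dimensional projective space: the set of all transversals of three
pairwise disjoint lines. -/
def IsRegulus (R : Set (Submodule F U)) : Prop :=
  ∃ a b c : Submodule F U, IsLn a ∧ IsLn b ∧ IsLn c ∧
    Disjoint a b ∧ Disjoint a c ∧ Disjoint b c ∧ R = transversals a b c

/-- The regulus through three pairwise disjoint lines `a`, `b`, `c` of a three-dimensional
projective space: the set of all lines that meet every transversal of `a`, `b`, `c`. -/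
def regulusThrough (a b c : Submodule F U) : Set (Submodule F U) :=
  {m | IsLn m ∧ ∀ t ∈ transversals a b c, Meets m t}

/-- A line spread: a set of lines such that every point is on exactly one of them. -/
def IsLineSpread (S : Set (Submodule F U)) : Prop :=
  (∀ ℓ ∈ S, IsLn ℓ) ∧ ∀ P : Submodule F U, IsPt P → ∃! ℓ, ℓ ∈ S ∧ P ≤ ℓ

/-- A regular line spread: with any three of its lines it contains the regulus through them. -/
def IsRegularSpread (S : Set (Submodule F U)) : Prop :=
  IsLineSpread S ∧
    ∀ a ∈ S, ∀ b ∈ S, ∀ c ∈ S, a ≠ b → a ≠ c → b ≠ c → regulusThrough a b c ⊆ S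

/-- A linear congruence: the set of all lines whose Plücker coordinates satisfy two linearly
independent linear equations. A linear form `∑ i < j, aᵢⱼ pᵢⱼ` in the Plücker coordinates
`pᵢⱼ = uᵢ vⱼ - uⱼ vᵢ` of the line `⟨u, v⟩` is the value at `(u, v)` of an alternating bilinear
form. -/
def IsLinearCongruence (C : Set (Submodule F U)) : Prop :=
  ∃ B₁ B₂ : U →ₗ[F] U →ₗ[F] F, B₁.IsAlt ∧ B₂.IsAlt ∧ LinearIndependent F ![B₁, B₂] ∧
    C = {ℓ | IsLn ℓ ∧ ∀ u ∈ ℓ, ∀ v ∈ ℓ, B₁ u v = 0 ∧ B₂ u v = 0}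

/-- An elliptic linear congruence: a linear congruence that is a regular line spread. -/
def IsEllipticCongruence (C : Set (Submodule F U)) : Prop :=
  IsLinearCongruence C ∧ IsRegularSpread C

/-- A parabolic linear congruence with axis `ℓ`, over the field of order `q`: a linear congruence
that consists of `ℓ` and of a set of `q² + q` further lines such that each of these meets `ℓ`,
any two of them are disjoint or meet in a point of `ℓ`, and they contain a regulus. -/
def IsParabolicCongruence (C : Set (Submodule F U)) (ℓ : Submodule F U) : Prop :=
  IsLinearCongruence C ∧ IsLn ℓ ∧ ℓ ∈ C ∧
    (C \ {ℓ}).ncard = Nat.card F ^ 2 + Nat.card F ∧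
    (∀ m ∈ C \ {ℓ}, IsLn m ∧ Meets m ℓ) ∧
    (∀ m ∈ C \ {ℓ}, ∀ m' ∈ C \ {ℓ}, m ≠ m' → Disjoint m m' ∨ m ⊓ m' ≤ ℓ) ∧
    ∃ R ⊆ C \ {ℓ}, IsRegulus R

/-- A hyperbolic linear congruence with axes `ℓ₁`, `ℓ₂`: a linear congruence that is the set of
all lines that meet both of the disjoint lines `ℓ₁`, `ℓ₂`. -/
def IsHyperbolicCongruence (C : Set (Submodule F U)) (ℓ₁ ℓ₂ : Submodule F U) : Prop :=
  IsLinearCongruence C ∧ IsLn ℓ₁ ∧ IsLn ℓ₂ ∧ Disjoint ℓ₁ ℓ₂ ∧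
    C = {m | IsLn m ∧ Meets m ℓ₁ ∧ Meets m ℓ₂}

end Congruences

/-! ### Field reduction

`K` is the cubic extension of `F = 𝔽_q` and `V` a three-dimensional `K`-space, so `V` gives
`PG(2, q³)` over `K` and `PG(8, q)` over `F`. A collineation of `PG(2, q³)` is an automorphism `φ`
of the lattice of `K`-subspaces. A projectivity of `PG(8, q)` is given by an `F`-linear
automorphism `σ` of `V`. The `𝕊`-planes and the `ℍ`-5-spaces are the points and the lines of
`PG(2, q³)`, regarded as `F`-subspaces. -/

section FieldReduction

variable {F K V : Type*} [Field F] [Field K] [Algebra F K] [AddCommGroup V] [Module F V]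
  [Module K V] [IsScalarTower F K V]

variable (F) in
/-- `φ` fixes an `𝔽_q`-plane pointwise, that is, all points of `PG(2, q³)` that have coordinates
in `F` with respect to a suitable `K`-basis of `V`. -/
def FixesSubplane (φ : Submodule K V ≃o Submodule K V) : Prop :=
  ∃ b : Module.Basis (Fin 3) K V, ∀ v ∈ Submodule.span F (Set.range b),
    φ (Submodule.span K {v}) = Submodule.span K {v}

/-- `σ` is a projectivity of `PG(8, q)` induced by the collineation `φ` of `PG(2, q³)`. -/
def Induces (φ : Submodule K V ≃o Submodule K V) (σ : V ≃ₗ[F] V) : Prop :=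
  ∀ X : Submodule K V,
    (X.restrictScalars F).map (σ : V →ₗ[F] V) = (φ X).restrictScalars F

/-- The point `Q` of `PG(2, q³)` has Type I: it is fixed by `φ`. -/
def IsTypeIPoint (φ : Submodule K V ≃o Submodule K V) (Q : Submodule K V) : Prop :=
  IsPt Q ∧ φ Q = Q

/-- The point `Q` of `PG(2, q³)` has Type II: its orbit under `φ` (of order three) consists of
three collinear points. -/
def IsTypeIIPoint (φ : Submodule K V ≃o Submodule K V) (Q : Submodule K V) : Prop :=
  IsPt Q ∧ φ Q ≠ Q ∧ ∃ m : Submodule K V, IsLn m ∧ Q ≤ m ∧ φ Q ≤ m ∧ φ (φ Q) ≤ m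

/-- An `𝕊_I`-plane of `PG(8, q)`. -/
def IsSIPlane (φ : Submodule K V ≃o Submodule K V) (A : Submodule F V) : Prop :=
  ∃ Q : Submodule K V, IsTypeIPoint φ Q ∧ A = Q.restrictScalars F

/-- An `𝕊_II`-plane of `PG(8, q)`. -/
def IsSIIPlane (φ : Submodule K V ≃o Submodule K V) (A : Submodule F V) : Prop :=
  ∃ Q : Submodule K V, IsTypeIIPoint φ Q ∧ A = Q.restrictScalars F

/-- An `ℍ_I`-5-space of `PG(8, q)`: it corresponds to a line of `PG(2, q³)` fixed by `φ`. -/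
def IsHI5Space (φ : Submodule K V ≃o Submodule K V) (H : Submodule F V) : Prop :=
  ∃ m : Submodule K V, IsLn m ∧ φ m = m ∧ H = m.restrictScalars F

/-- The subspace `X` of `PG(8, q)` is fixed by `σ`. -/
def IsFixed (σ : V ≃ₗ[F] V) (X : Submodule F V) : Prop :=
  X.map (σ : V →ₗ[F] V) = X

/-- The points `P`, `P^σ`, `P^(σ²)` are collinear. -/
def HasCollinearOrbit (σ : V ≃ₗ[F] V) (P : Submodule F V) : Prop :=
  ∃ ℓ : Submodule F V, IsLn ℓ ∧ P ≤ ℓ ∧ P.map (σ : V →ₗ[F] V) ≤ ℓ ∧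
    (P.map (σ : V →ₗ[F] V)).map (σ : V →ₗ[F] V) ≤ ℓ

/-- A `I_:`-point of `PG(8, q)`: a point on an `𝕊_I`-plane that is not fixed and whose orbit is
collinear. -/
def IsIColonPoint (φ : Submodule K V ≃o Submodule K V) (σ : V ≃ₗ[F] V)
    (P : Submodule F V) : Prop :=
  IsPt P ∧ (∃ A : Submodule F V, IsSIPlane φ A ∧ P ≤ A) ∧ ¬ IsFixed σ P ∧ HasCollinearOrbit σ P

/-- A `II_:`-point of `PG(8, q)`: a point on an `𝕊_II`-plane whose orbit is collinear. -/
def IsIIColonPoint (φ : Submodule K V ≃o Submodule K V) (σ : V ≃ₗ[F] V)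
    (P : Submodule F V) : Prop :=
  IsPt P ∧ (∃ A : Submodule F V, IsSIIPlane φ A ∧ P ≤ A) ∧ HasCollinearOrbit σ P

/-- A ptwise-fixed line of `PG(8, q)`. -/
def IsPtwiseFixedLine (σ : V ≃ₗ[F] V) (ℓ : Submodule F V) : Prop :=
  IsLn ℓ ∧ ∀ P : Submodule F V, IsPt P → P ≤ ℓ → IsFixed σ P

/-- A fixed-I-line of `PG(8, q)`: a fixed line in an `𝕊_I`-plane that is not fixed pointwise and
whose non-fixed points are `I_:`-points. -/
def IsFixedILine (φ : Submodule K V ≃o Submodule K V) (σ : V ≃ₗ[F] V)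
    (ℓ : Submodule F V) : Prop :=
  IsLn ℓ ∧ IsFixed σ ℓ ∧ (∃ P : Submodule F V, P ≤ ℓ ∧ IsIColonPoint φ σ P) ∧
    (∀ P : Submodule F V, IsPt P → P ≤ ℓ → IsFixed σ P ∨ IsIColonPoint φ σ P) ∧
    ∃ A : Submodule F V, IsSIPlane φ A ∧ ℓ ≤ A

/-- A fixed-II-line of `PG(8, q)`: a fixed line in an `ℍ_I`-5-space that is not fixed pointwise
and whose non-fixed points are `II_:`-points. -/
def IsFixedIILine (φ : Submodule K V ≃o Submodule K V) (σ : V ≃ₗ[F] V)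
    (ℓ : Submodule F V) : Prop :=
  IsLn ℓ ∧ IsFixed σ ℓ ∧ (∃ P : Submodule F V, P ≤ ℓ ∧ IsIIColonPoint φ σ P) ∧
    (∀ P : Submodule F V, IsPt P → P ≤ ℓ → IsFixed σ P ∨ IsIIColonPoint φ σ P) ∧
    ∃ H : Submodule F V, IsHI5Space φ H ∧ ℓ ≤ H

/-- A hwise-fixed-5-space of `PG(8, q)`: every hyperplane that contains it is fixed. -/
def IsHwiseFixed5Space (σ : V ≃ₗ[F] V) (W : Submodule F V) : Prop :=
  Module.finrank F W = 6 ∧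
    ∀ X : Submodule F V, Module.finrank F X = 8 → W ≤ X → IsFixed σ X

/-- The fixed-I-lines and fixed-II-lines contained in the subspace `S` of `PG(8, q)`, regarded as
lines of the projective space `S`. -/
def fixedLinesIn (φ : Submodule K V ≃o Submodule K V) (σ : V ≃ₗ[F] V) (S : Submodule F V) :
    Set (Submodule F S) :=
  {ℓ | IsFixedILine φ σ (ℓ.map S.subtype) ∨ IsFixedIILine φ σ (ℓ.map S.subtype)}

/-- The ptwise-fixed lines contained in the subspace `S` of `PG(8, q)`, regarded as lines of the
projective space `S`. -/
def ptwiseFixedLinesIn (σ : V ≃ₗ[F] V) (S : Submodule F V) : Set (Submodule F S) :=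
  {ℓ | IsPtwiseFixedLine σ (ℓ.map S.subtype)}

end FieldReduction

/-! ### Lines as spans of two vectors -/

section LinesBasics

variable {F U : Type*} [Field F] [AddCommGroup U] [Module F U]

/-! Put `A = F[X] / (X² + X + 1)`. The intersection `Σ₃` turns out to be a free `A`-module of rank
two, and the three cases are the three shapes of `A`: a field, dual numbers over `F`, or `F × F`.

A scalar multiple `s` of `σ` acts on coordinates, in a suitable `K`-basis, through an automorphism
`τ ≠ 1` of `K` over `F`, so `s³ = 1`. Since `σ` is scalar modulo `W`, a dimension count gives `W =
range (s - 1) = ker (1 + s + s²)`: the vectors whose coordinates have trace zero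
(`exists_isCoordinatewise`). An `ℍ_I`-5-space is an `s`-invariant `K`-line, and Galois descent
writes it as `K v ⊕ K w` with `v`, `w` fixed by `s`. Hence `Σ₃ = T v ⊕ T w`, where `T`, the elements
of trace zero, has an `F`-basis `t`, `τ t` and is free of rank one over `A`
(`IsCoordinatewise.exists_isOrderThreeBasis`).

The fixed-I- and fixed-II-lines in `Σ₃` are the invariant lines not fixed pointwise
(`isFixedILine_or_isFixedIILine_iff`), that is, the lines `⟨x, s x⟩` with `x` not an eigenvector.
The two `F`-components of the `A`-valued determinant are alternating forms that vanish on these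
lines; conversely a line on which both vanish is invariant. The pointwise fixed lines are the
eigenspaces of the roots of `X² + X + 1`, and they belong to this linear congruence only when `3 =
0`. Reguli come from `mem_movedLines_of_meets`, and the number of lines in the parabolic case from
`ncard_movedLines`. -/

theorem meets_iff {ℓ m : Submodule F U} : Meets ℓ m ↔ ∃ x ∈ ℓ, x ∈ m ∧ x ≠ 0 := by
  rw [Meets, Submodule.ne_bot_iff]
  simp only [Submodule.mem_inf, and_assoc]

theorem isLn_span_pair {x y : U} (h : LinearIndependent F ![x, y]) :
    IsLn (Submodule.span F {x, y}) := by
  have := finrank_span_eq_card h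
  rw [Matrix.range_cons, Matrix.range_cons, Matrix.range_empty, Set.union_empty,
    Set.singleton_union] at this
  exact this

theorem IsLn.finiteDimensional {ℓ : Submodule F U} (h : IsLn ℓ) : FiniteDimensional F ℓ :=
  FiniteDimensional.of_finrank_pos (by rw [IsLn] at h; omega)

theorem IsLn.eq_of_le {ℓ m : Submodule F U} (hℓ : IsLn ℓ) (hm : IsLn m) (h : ℓ ≤ m) : ℓ = m := by
  have := hm.finiteDimensional
  exact Submodule.eq_of_le_of_finrank_eq h (hℓ.trans hm.symm)

theorem IsLn.eq_span_pair {ℓ : Submodule F U} (hℓ : IsLn ℓ) {x y : U} (hx : x ∈ ℓ) (hy : y ∈ ℓ)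
    (h : LinearIndependent F ![x, y]) : ℓ = Submodule.span F {x, y} := by
  refine ((isLn_span_pair h).eq_of_le hℓ ?_).symm
  rw [Submodule.span_le]
  rintro z (rfl | rfl) <;> assumption

theorem IsLn.exists_basis {ℓ : Submodule F U} (hℓ : IsLn ℓ) :
    ∃ x y : U, LinearIndependent F ![x, y] ∧ ℓ = Submodule.span F {x, y} := by
  have := hℓ.finiteDimensional
  let b := Module.finBasisOfFinrankEq F ℓ hℓ
  have h : LinearIndependent F ![(b 0 : U), (b 1 : U)] := by
    have := b.linearIndependent.map' ℓ.subtype ℓ.ker_subtype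
    have he : ![(b 0 : U), (b 1 : U)] = ℓ.subtype ∘ b := by
      ext i; fin_cases i <;> rfl
    rw [he]; exact this
  exact ⟨b 0, b 1, h, hℓ.eq_span_pair (b 0).2 (b 1).2 h⟩

theorem IsPt.exists_eq_span {P : Submodule F U} (hP : IsPt P) :
    ∃ x : U, x ≠ 0 ∧ P = Submodule.span F {x} := by
  obtain ⟨v, hv, h⟩ := finrank_eq_one_iff'.1 hP
  refine ⟨v, by simpa using hv, le_antisymm (fun x hx => ?_) ?_⟩
  · obtain ⟨c, hc⟩ := h ⟨x, hx⟩
    exact Submodule.mem_span_singleton.2 ⟨c, congrArg Subtype.val hc⟩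
  · rw [Submodule.span_singleton_le_iff_mem]; exact v.2

theorem isPt_span {x : U} (hx : x ≠ 0) : IsPt (Submodule.span F {x}) :=
  finrank_span_singleton hx

/-- The alternating form `f ∧ g`. -/
def wedgeForm (f g : U →ₗ[F] F) : U →ₗ[F] U →ₗ[F] F :=
  LinearMap.mk₂ F (fun x y => f x * g y - g x * f y)
    (by intros; simp only [map_add]; ring) (by intros; simp only [map_smul, smul_eq_mul]; ring)
    (by intros; simp only [map_add]; ring) (by intros; simp only [map_smul, smul_eq_mul]; ring)

end LinesBasics

/-! ### Invariant lines and the determinant over `F[s] / (s² + s + 1)` -/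

section Abstract

variable {F U : Type*} [Field F] [AddCommGroup U] [Module F U]

/-- The lines that are invariant under `s` but not fixed pointwise. -/
def movedLines (s : U →ₗ[F] U) : Set (Submodule F U) :=
  {ℓ | IsLn ℓ ∧ (∀ x ∈ ℓ, s x ∈ ℓ) ∧ ∃ x ∈ ℓ, ∀ μ : F, s x ≠ μ • x}

/-- The lines all of whose points are fixed by `s`. -/
def eigenLines (s : U →ₗ[F] U) : Set (Submodule F U) :=
  {ℓ | IsLn ℓ ∧ ∀ x ∈ ℓ, ∃ μ : F, s x = μ • x}

theorem linearIndependent_of_moved {s : U →ₗ[F] U} {x : U} (hx : ∀ μ : F, s x ≠ μ • x) :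
    LinearIndependent F ![x, s x] := by
  have h0 : x ≠ 0 := by rintro rfl; exact hx 0 (by simp)
  exact (LinearIndependent.pair_iff' h0).2 fun a h => hx a h.symm

theorem eq_span_of_moved {s : U →ₗ[F] U} {ℓ : Submodule F U} (hℓ : IsLn ℓ)
    {x : U} (hx : ∀ μ : F, s x ≠ μ • x) (hxl : x ∈ ℓ) (hsx : s x ∈ ℓ) :
    ℓ = Submodule.span F {x, s x} :=
  hℓ.eq_span_pair hxl hsx (linearIndependent_of_moved hx)

/-- If every vector of `p` is an eigenvector of `s`, then `s` acts on `p` as a scalar. -/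
theorem exists_eigenvalue {s : U →ₗ[F] U} {p : Submodule F U}
    (h : ∀ x ∈ p, ∃ μ : F, s x = μ • x) : ∃ μ : F, ∀ x ∈ p, s x = μ • x := by
  have hinv : ∀ x ∈ p, s x ∈ p := fun x hx => by
    obtain ⟨μ, hμ⟩ := h x hx
    rw [hμ]; exact p.smul_mem _ hx
  obtain ⟨a, ha⟩ := LinearMap.exists_eq_smul_id_of_forall_notLinearIndependent
    (f := s.restrict hinv) (fun v hv => by
      obtain ⟨μ, hμ⟩ := h v v.2
      have := LinearIndependent.pair_iff.1 hv μ (-1) (by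
        ext; simp [hμ])
      simp at this)
  refine ⟨a, fun x hx => ?_⟩
  have := congrArg Subtype.val (LinearMap.congr_fun ha ⟨x, hx⟩)
  simpa using this

/-- `b` exhibits `U` as a free module of rank two over `F[s] / (s² + s + 1)`. -/
structure IsOrderThreeBasis (s : U →ₗ[F] U) (b : Module.Basis (Fin 4) F U) : Prop where
  map0 : s (b 0) = b 2
  map1 : s (b 1) = b 3
  map2 : s (b 2) = -b 0 - b 2
  map3 : s (b 3) = -b 1 - b 3

/-- The first component of the determinant over `F[s] / (s² + s + 1)`. -/
noncomputable def detForm₁ (b : Module.Basis (Fin 4) F U) : U →ₗ[F] U →ₗ[F] F :=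
  wedgeForm (b.coord 0) (b.coord 1) - wedgeForm (b.coord 2) (b.coord 3)

/-- The second component of the determinant over `F[s] / (s² + s + 1)`. -/
noncomputable def detForm₂ (b : Module.Basis (Fin 4) F U) : U →ₗ[F] U →ₗ[F] F :=
  wedgeForm (b.coord 0) (b.coord 3) + wedgeForm (b.coord 2) (b.coord 1) -
    wedgeForm (b.coord 2) (b.coord 3)

namespace IsOrderThreeBasis

variable {s : U →ₗ[F] U} {b : Module.Basis (Fin 4) F U} (hb : IsOrderThreeBasis s b)
include hb

theorem map_map (x : U) : s (s x) = -x - s x := by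
  have : s ∘ₗ s = -LinearMap.id - s := b.ext fun i => by
    fin_cases i <;> simp [hb.map0, hb.map1, hb.map2, hb.map3]
  exact LinearMap.congr_fun this x

theorem coord0 (x : U) : b.coord 0 (s x) = -b.coord 2 x := by
  have : b.coord 0 ∘ₗ s = -b.coord 2 := b.ext fun i => by
    fin_cases i <;> simp [hb.map0, hb.map1, hb.map2, hb.map3]
  exact LinearMap.congr_fun this x

theorem coord1 (x : U) : b.coord 1 (s x) = -b.coord 3 x := by
  have : b.coord 1 ∘ₗ s = -b.coord 3 := b.ext fun i => by
    fin_cases i <;> simp [hb.map0, hb.map1, hb.map2, hb.map3]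
  exact LinearMap.congr_fun this x

theorem coord2 (x : U) : b.coord 2 (s x) = b.coord 0 x - b.coord 2 x := by
  have : b.coord 2 ∘ₗ s = b.coord 0 - b.coord 2 := b.ext fun i => by
    fin_cases i <;> simp [hb.map0, hb.map1, hb.map2, hb.map3]
  exact LinearMap.congr_fun this x

theorem coord3 (x : U) : b.coord 3 (s x) = b.coord 1 x - b.coord 3 x := by
  have : b.coord 3 ∘ₗ s = b.coord 1 - b.coord 3 := b.ext fun i => by
    fin_cases i <;> simp [hb.map0, hb.map1, hb.map2, hb.map3]
  exact LinearMap.congr_fun this x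

end IsOrderThreeBasis

theorem detForm₁_apply (b : Module.Basis (Fin 4) F U) (x y : U) :
    detForm₁ b x y = b.coord 0 x * b.coord 1 y - b.coord 1 x * b.coord 0 y -
      (b.coord 2 x * b.coord 3 y - b.coord 3 x * b.coord 2 y) := rfl

theorem detForm₂_apply (b : Module.Basis (Fin 4) F U) (x y : U) :
    detForm₂ b x y = b.coord 0 x * b.coord 3 y - b.coord 3 x * b.coord 0 y +
      (b.coord 2 x * b.coord 1 y - b.coord 1 x * b.coord 2 y) -
      (b.coord 2 x * b.coord 3 y - b.coord 3 x * b.coord 2 y) := rfl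

theorem detForm₁_isAlt (b : Module.Basis (Fin 4) F U) : (detForm₁ b).IsAlt := fun x => by
  rw [detForm₁_apply]; ring

theorem detForm₂_isAlt (b : Module.Basis (Fin 4) F U) : (detForm₂ b).IsAlt := fun x => by
  rw [detForm₂_apply]; ring

theorem detForm_linearIndependent (b : Module.Basis (Fin 4) F U) :
    LinearIndependent F ![detForm₁ b, detForm₂ b] := by
  refine (LinearIndependent.pair_iff (R := F) (M := U →ₗ[F] U →ₗ[F] F)).2 fun p q h => ?_
  have h1 := LinearMap.congr_fun (LinearMap.congr_fun h (b 0)) (b 1)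
  have h2 := LinearMap.congr_fun (LinearMap.congr_fun h (b 0)) (b 3)
  simp [detForm₁_apply, detForm₂_apply] at h1 h2
  exact ⟨h1, h2⟩

theorem detForm₁_nondegenerate (b : Module.Basis (Fin 4) F U) :
    LinearMap.BilinForm.Nondegenerate (detForm₁ b) := by
  have : Module.Finite F U := Module.Finite.of_basis b
  rw [LinearMap.BilinForm.nondegenerate_iff_ker_eq_bot, LinearMap.ker_eq_bot']
  intro x hx
  have h0 := LinearMap.congr_fun hx (b 0)
  have h1 := LinearMap.congr_fun hx (b 1)
  have h2 := LinearMap.congr_fun hx (b 2)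
  have h3 := LinearMap.congr_fun hx (b 3)
  simp [detForm₁_apply] at h0 h1 h2 h3
  refine b.repr.map_eq_zero_iff.1 (Finsupp.ext fun i => ?_)
  fin_cases i <;> simp [h0, h1, h2, h3]

/-- The lines on which the determinant over `F[s] / (s² + s + 1)` vanishes. -/
def detCongruence (b : Module.Basis (Fin 4) F U) : Set (Submodule F U) :=
  {ℓ | IsLn ℓ ∧ ∀ u ∈ ℓ, ∀ v ∈ ℓ, detForm₁ b u v = 0 ∧ detForm₂ b u v = 0}

theorem isLinearCongruence_detCongruence (b : Module.Basis (Fin 4) F U) :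
    IsLinearCongruence (detCongruence b) :=
  ⟨_, _, detForm₁_isAlt b, detForm₂_isAlt b, detForm_linearIndependent b, rfl⟩

theorem mem_detCongruence_of_span {b : Module.Basis (Fin 4) F U} {ℓ : Submodule F U}
    (hℓ : IsLn ℓ) {x y : U} (h : ℓ = Submodule.span F {x, y})
    (h1 : detForm₁ b x y = 0) (h2 : detForm₂ b x y = 0) : ℓ ∈ detCongruence b := by
  refine ⟨hℓ, fun u hu v hv => ?_⟩
  subst h
  obtain ⟨p, q, rfl⟩ := Submodule.mem_span_pair.1 hu
  obtain ⟨p', q', rfl⟩ := Submodule.mem_span_pair.1 hv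
  have h1' : detForm₁ b y x = 0 := by rw [← (detForm₁_isAlt b).neg, h1, neg_zero]
  have h2' : detForm₂ b y x = 0 := by rw [← (detForm₂_isAlt b).neg, h2, neg_zero]
  simp [h1, h2, h1', h2', (detForm₁_isAlt b).self_eq_zero, (detForm₂_isAlt b).self_eq_zero]

namespace IsOrderThreeBasis

variable {s : U →ₗ[F] U} {b : Module.Basis (Fin 4) F U} (hb : IsOrderThreeBasis s b)
include hb

/-- The vectors `x` and `s x` are proportional over `F[s]`, so their determinant vanishes. -/
theorem movedLines_subset_detCongruence : movedLines s ⊆ detCongruence b := by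
  rintro ℓ ⟨hℓ, hinv, x, hx, hne⟩
  refine mem_detCongruence_of_span hℓ (eq_span_of_moved hℓ hne hx (hinv x hx)) ?_ ?_
  · rw [detForm₁_apply, hb.coord0, hb.coord1, hb.coord2, hb.coord3]; ring
  · rw [detForm₂_apply, hb.coord0, hb.coord1, hb.coord2, hb.coord3]; ring

/-- A totally isotropic line of a nondegenerate alternating form in dimension four is its own
orthogonal space. As the determinant is `F[s]`-linear, the first component at `(n, s x)` is minus
the second at `(n, x)`, so `s x` is again orthogonal to the line. -/
theorem invariant_of_mem_detCongruence {ℓ : Submodule F U} (hℓ : ℓ ∈ detCongruence b) :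
    ∀ x ∈ ℓ, s x ∈ ℓ := by
  have : Module.Finite F U := Module.Finite.of_basis b
  have hfr : Module.finrank F U = 4 := by simpa using Module.finrank_eq_card_basis b
  have horth : ℓ = LinearMap.BilinForm.orthogonal (detForm₁ b) ℓ := by
    refine Submodule.eq_of_le_of_finrank_eq (fun x hx => ?_) ?_
    · exact LinearMap.BilinForm.mem_orthogonal_iff.2 fun n hn => (hℓ.2 n hn x hx).1
    · have h2 : Module.finrank F ℓ = 2 := hℓ.1
      rw [LinearMap.BilinForm.finrank_orthogonal (detForm₁_nondegenerate b), hfr, h2]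
  intro x hx
  rw [horth, LinearMap.BilinForm.mem_orthogonal_iff]
  intro n hn
  have : detForm₁ b n (s x) = -detForm₂ b n x := by
    rw [detForm₁_apply, detForm₂_apply, hb.coord0, hb.coord1, hb.coord2, hb.coord3]; ring
  rw [this, (hℓ.2 n hn x hx).2, neg_zero]

theorem mem_movedLines_or_eigenLines {ℓ : Submodule F U} (hℓ : ℓ ∈ detCongruence b) :
    ℓ ∈ movedLines s ∨ ℓ ∈ eigenLines s := by
  by_cases h : ∃ x ∈ ℓ, ∀ μ : F, s x ≠ μ • x
  · exact .inl ⟨hℓ.1, hb.invariant_of_mem_detCongruence hℓ, h⟩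
  · push Not at h
    exact .inr ⟨hℓ.1, h⟩

theorem eigenvalue_sq_add {x : U} (hx : x ≠ 0) {μ : F} (h : s x = μ • x) :
    μ ^ 2 + μ + 1 = 0 := by
  have h1 := hb.map_map x
  rw [h, map_smul, h] at h1
  have : (μ ^ 2 + μ + 1) • x = 0 := by
    have : (μ ^ 2 + μ + 1) • x = μ • μ • x - (-x - μ • x) := by module
    rw [this, h1, sub_self]
  exact (smul_eq_zero.1 this).resolve_right hx

omit hb in
theorem linearIndependent_eigen (μ : F) :
    LinearIndependent F ![b 0 - μ • b 2, b 1 - μ • b 3] := by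
  rw [LinearIndependent.pair_iff]
  intro p q h
  have h0 := congrArg (b.coord 0) h
  have h1 := congrArg (b.coord 1) h
  simp at h0 h1
  exact ⟨h0, h1⟩

theorem eigenspace_eq_span {μ : F} (hμ : μ ^ 2 + μ + 1 = 0) :
    LinearMap.ker (s - μ • LinearMap.id) =
      Submodule.span F {b 0 - μ • b 2, b 1 - μ • b 3} := by
  have key : ∀ x, x ∈ LinearMap.ker (s - μ • LinearMap.id) ↔ s x = μ • x := fun x => by
    simp [sub_eq_zero]
  refine le_antisymm (fun x hx => ?_) ?_
  · rw [key] at hx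
    have h2 := congrArg (b.coord 0) hx
    have h3 := congrArg (b.coord 1) hx
    rw [hb.coord0] at h2
    rw [hb.coord1] at h3
    refine Submodule.mem_span_pair.2 ⟨b.coord 0 x, b.coord 1 x, ?_⟩
    refine b.ext_elem fun i => ?_
    simp only [map_smul, smul_eq_mul, Module.Basis.coord_apply] at h2 h3
    fin_cases i <;> simp
    · linear_combination h2
    · linear_combination h3
  · rw [Submodule.span_le]
    rintro x (rfl | rfl)
    · refine (key _).2 ?_
      rw [map_sub, map_smul, hb.map0, hb.map2, ← sub_eq_zero]
      have : b 2 - μ • (-b 0 - b 2) - μ • (b 0 - μ • b 2) =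
          (μ ^ 2 + μ + 1) • b 2 := by module
      rw [this, hμ, zero_smul]
    · refine (key _).2 ?_
      rw [map_sub, map_smul, hb.map1, hb.map3, ← sub_eq_zero]
      have : b 3 - μ • (-b 1 - b 3) - μ • (b 1 - μ • b 3) =
          (μ ^ 2 + μ + 1) • b 3 := by module
      rw [this, hμ, zero_smul]

end IsOrderThreeBasis
end Abstract

/-! ### Reguli, counting, and the three types of congruence -/

section Abstract

variable {F U : Type*} [Field F] [AddCommGroup U] [Module F U]

/-- A line that meets `⟨x, y⟩`, `⟨s x, s y⟩` and `⟨x + s x, y + s y⟩` is invariant under `s`. -/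
theorem mem_movedLines_of_meets {s : U →ₗ[F] U} (hs : ∀ z, s (s z) = -z - s z) {x y : U}
    (hind : ∀ p q p' q' : F, p • x + q • y + p' • s x + q' • s y = 0 →
      p = 0 ∧ q = 0 ∧ p' = 0 ∧ q' = 0)
    {m : Submodule F U} (hm : IsLn m) (h1 : Meets m (Submodule.span F {x, y}))
    (h2 : Meets m (Submodule.span F {s x, s y}))
    (h3 : Meets m (Submodule.span F {x + s x, y + s y})) : m ∈ movedLines s := by
  obtain ⟨u, hum, hu, hu0⟩ := meets_iff.1 h1
  obtain ⟨v, hvm, hv, hv0⟩ := meets_iff.1 h2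
  obtain ⟨w, hwm, hw, hw0⟩ := meets_iff.1 h3
  obtain ⟨a, a', rfl⟩ := Submodule.mem_span_pair.1 hu
  obtain ⟨c, c', rfl⟩ := Submodule.mem_span_pair.1 hv
  obtain ⟨d, d', rfl⟩ := Submodule.mem_span_pair.1 hw
  have huv : LinearIndependent F ![a • x + a' • y, c • s x + c' • s y] := by
    refine (LinearIndependent.pair_iff' hu0).2 fun k hk => hv0 ?_
    obtain ⟨-, -, h, h'⟩ := hind (k * a) (k * a') (-c) (-c') (by
      rw [← sub_eq_zero] at hk; rw [← hk]; module)
    rw [neg_eq_zero] at h h'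
    simp [h, h']
  have hm' := hm.eq_span_pair hum hvm huv
  rw [hm'] at hwm
  obtain ⟨k, l, hkl⟩ := Submodule.mem_span_pair.1 hwm
  obtain ⟨e1, e2, e3, e4⟩ := hind (k * a - d) (k * a' - d') (l * c - d) (l * c' - d') (by
    rw [← sub_eq_zero] at hkl; rw [← hkl]; module)
  have hk : k ≠ 0 := by
    rintro rfl
    rw [zero_mul, zero_sub, neg_eq_zero] at e1 e2
    exact hw0 (by simp [e1, e2])
  -- Comparing coefficients in `w = k u + l v` gives `k a = d = l c` and `k a' = d' = l c'`, so the
  -- second point of `m` is the image of the first.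
  have hsu : s (a • x + a' • y) = (k⁻¹ * l) • (c • s x + c' • s y) := by
    have h : a = k⁻¹ * l * c := by field_simp; linear_combination e1 - e3
    have h' : a' = k⁻¹ * l * c' := by field_simp; linear_combination e2 - e4
    rw [map_add, map_smul, map_smul, smul_add, smul_smul, smul_smul, ← h, ← h']
  have hne : ∀ μ : F, s (a • x + a' • y) ≠ μ • (a • x + a' • y) := fun μ hμ => by
    obtain ⟨-, -, h, h'⟩ := hind (-(μ * a)) (-(μ * a')) a a' (by
      rw [← sub_eq_zero, map_add, map_smul, map_smul] at hμ; rw [← hμ]; module)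
    exact hu0 (by simp [h, h'])
  have hsum : s (a • x + a' • y) ∈ m := by rw [hsu]; exact m.smul_mem _ hvm
  refine ⟨hm, fun z hz => ?_, _, hum, hne⟩
  rw [eq_span_of_moved hm hne hum hsum] at hz
  obtain ⟨p, q, rfl⟩ := Submodule.mem_span_pair.1 hz
  rw [map_add, map_smul s p, map_smul s q, hs]
  exact m.add_mem (m.smul_mem _ hsum) (m.smul_mem _ (m.sub_mem (m.neg_mem hum) hsum))

theorem span_mem_movedLines {s : U →ₗ[F] U} (hs : ∀ z, s (s z) = -z - s z) {x : U}
    (hx : ∀ μ : F, s x ≠ μ • x) : Submodule.span F {x, s x} ∈ movedLines s := by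
  refine ⟨isLn_span_pair (linearIndependent_of_moved hx), fun z hz => ?_, x,
    Submodule.subset_span (by simp), hx⟩
  obtain ⟨p, q, rfl⟩ := Submodule.mem_span_pair.1 hz
  refine Submodule.mem_span_pair.2 ⟨-q, p - q, ?_⟩
  rw [map_add, map_smul, map_smul, hs]
  module

theorem mem_ker_sub_smul {s : U →ₗ[F] U} {μ : F} {x : U} :
    x ∈ LinearMap.ker (s - μ • LinearMap.id) ↔ s x = μ • x := by
  simp [sub_eq_zero]

theorem movedLines_disjoint_eigenLines {s : U →ₗ[F] U} {ℓ : Submodule F U}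
    (h : ℓ ∈ movedLines s) : ℓ ∉ eigenLines s := fun h' => by
  obtain ⟨x, hx, hne⟩ := h.2.2
  obtain ⟨μ, hμ⟩ := h'.2 x hx
  exact hne μ hμ

theorem span_mem_transversals {a b c : Submodule F U} {u v : U} (hu : u ∈ a) (hv : v ∈ b)
    (huv : u + v ∈ c) (h : LinearIndependent F ![u, v]) :
    Submodule.span F {u, v} ∈ transversals a b c := by
  have hmu : u ∈ Submodule.span F {u, v} := Submodule.subset_span (by simp)
  have hmv : v ∈ Submodule.span F {u, v} := Submodule.subset_span (by simp)
  have hu0 : u ≠ 0 := by simpa using h.ne_zero 0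
  have hv0 : v ≠ 0 := by simpa using h.ne_zero 1
  have huv0 : u + v ≠ 0 := fun h0 => by
    have := LinearIndependent.pair_iff.1 h 1 1 (by simpa using h0)
    simp at this
  exact ⟨isLn_span_pair h, meets_iff.2 ⟨u, hmu, hu, hu0⟩, meets_iff.2 ⟨v, hmv, hv, hv0⟩,
    meets_iff.2 ⟨u + v, Submodule.add_mem _ hmu hmv, huv, huv0⟩⟩

/-- If `s` moves the points outside the line `ℓ`, and the invariant lines meet `ℓ`, then each
invariant line other than `ℓ` contains `q² - q` of the `q⁴ - q²` vectors outside `ℓ`. -/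
theorem ncard_movedLines [Finite F] [Module.Finite F U] {s : U →ₗ[F] U}
    (hs : ∀ z, s (s z) = -z - s z) (hfr : Module.finrank F U = 4) {ℓ : Submodule F U}
    (hℓ : IsLn ℓ) (hmv : ∀ x ∉ ℓ, ∀ μ : F, s x ≠ μ • x)
    (hmeet : ∀ m ∈ movedLines s, Meets m ℓ) (hℓm : ℓ ∉ movedLines s) :
    (movedLines s).ncard = Nat.card F ^ 2 + Nat.card F := by
  classical
  have : Finite U := Module.finite_of_finite F
  have : Finite (Submodule F U) := Finite.of_injective _ SetLike.coe_injective
  have hcard : ∀ p : Submodule F U, (p : Set U).ncard = Nat.card F ^ Module.finrank F p :=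
    fun p => by rw [← Nat.card_coe_set_eq]; exact Module.natCard_eq_pow_finrank
  have hfib : ∀ m ∈ movedLines s, ((m : Set U) \ ℓ).ncard = Nat.card F ^ 2 - Nat.card F := by
    intro m hm
    have h2 : Module.finrank F m = 2 := hm.1
    have h1 : Module.finrank F (m ⊓ ℓ : Submodule F U) = 1 := by
      have hle := Submodule.finrank_mono (inf_le_left : m ⊓ ℓ ≤ m)
      have hpos : Module.finrank F (m ⊓ ℓ : Submodule F U) ≠ 0 := fun h =>
        hmeet m hm (Submodule.finrank_eq_zero.1 h)
      have hne : Module.finrank F (m ⊓ ℓ : Submodule F U) ≠ 2 := fun h => by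
        have := Submodule.eq_of_le_of_finrank_eq (inf_le_left : m ⊓ ℓ ≤ m) (h.trans h2.symm)
        exact hℓm (hm.1.eq_of_le hℓ (inf_eq_left.1 this) ▸ hm)
      omega
    rw [← Set.sdiff_self_inter, Set.ncard_sdiff Set.inter_subset_left, ← Submodule.coe_inf, hcard,
      hcard, h1, h2, pow_one]
  let A : Finset U := (Set.toFinite ((ℓ : Set U)ᶜ)).toFinset
  let M : Finset (Submodule F U) := (Set.toFinite (movedLines s)).toFinset
  have hA : A.card = Nat.card F ^ 4 - Nat.card F ^ 2 := by
    have h2 : Module.finrank F ℓ = 2 := hℓ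
    rw [← Set.ncard_eq_toFinset_card, Set.ncard_compl, hcard, h2, ← hfr,
      Module.natCard_eq_pow_finrank (K := F)]
  -- A vector `x` outside `ℓ` lies on exactly one moved line, `⟨x, s x⟩`; the fibres of this map are
  -- counted.
  have hsum := Finset.card_eq_sum_card_fiberwise (f := fun x => Submodule.span F {x, s x})
    (s := A) (t := M) (fun x hx => by
      have hx' : x ∉ ℓ := by simpa [A] using hx
      simpa [M] using span_mem_movedLines hs (hmv x hx'))
  rw [Finset.sum_congr rfl (g := fun _ => Nat.card F ^ 2 - Nat.card F) (fun m hm => ?_),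
    Finset.sum_const, hA, smul_eq_mul, ← Set.ncard_eq_toFinset_card] at hsum
  · have hq : 1 < Nat.card F := Finite.one_lt_card
    -- This `q` is the order of `F` minus two, so that no truncated subtraction remains.
    obtain ⟨q, hq'⟩ := Nat.exists_eq_add_of_lt hq
    have e1 : Nat.card F ^ 2 - Nat.card F = Nat.card F * (q + 1) := by
      rw [hq']; apply Nat.sub_eq_of_eq_add; ring
    have e2 : Nat.card F ^ 4 - Nat.card F ^ 2 =
        (Nat.card F ^ 2 + Nat.card F) * (Nat.card F * (q + 1)) := by
      rw [hq']; apply Nat.sub_eq_of_eq_add; ring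
    rw [e1, e2] at hsum
    exact (Nat.eq_of_mul_eq_mul_right (by positivity) hsum).symm
  · have hm' : m ∈ movedLines s := by simpa [M] using hm
    rw [← hfib m hm', Set.ncard_eq_toFinset_card _ (Set.toFinite _)]
    congr 1
    ext x
    simp only [A, Finset.mem_filter, Set.Finite.mem_toFinset, Set.mem_compl_iff, SetLike.mem_coe,
      Set.mem_sdiff]
    refine ⟨fun ⟨h, h'⟩ => ⟨h' ▸ Submodule.subset_span (by simp), h⟩, fun ⟨h, h'⟩ => ⟨h', ?_⟩⟩
    exact (eq_span_of_moved hm'.1 (hmv x h') h (hm'.2.1 x h)).symm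

namespace IsOrderThreeBasis

variable {s : U →ₗ[F] U} {b : Module.Basis (Fin 4) F U} (hb : IsOrderThreeBasis s b)
include hb

theorem isLn_eigenspace {μ : F} (hμ : μ ^ 2 + μ + 1 = 0) :
    IsLn (LinearMap.ker (s - μ • LinearMap.id)) := by
  rw [hb.eigenspace_eq_span hμ]
  exact isLn_span_pair (linearIndependent_eigen μ)

theorem eigenspace_mem_eigenLines {μ : F} (hμ : μ ^ 2 + μ + 1 = 0) :
    LinearMap.ker (s - μ • LinearMap.id) ∈ eigenLines s :=
  ⟨hb.isLn_eigenspace hμ, fun _ hx => ⟨μ, mem_ker_sub_smul.1 hx⟩⟩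

theorem exists_eq_eigenspace {ℓ : Submodule F U} (hℓ : ℓ ∈ eigenLines s) :
    ∃ μ : F, μ ^ 2 + μ + 1 = 0 ∧ ℓ = LinearMap.ker (s - μ • LinearMap.id) := by
  obtain ⟨μ, hμ⟩ := exists_eigenvalue hℓ.2
  obtain ⟨x, y, hxy, rfl⟩ := hℓ.1.exists_basis
  have hroot := hb.eigenvalue_sq_add (by simpa using hxy.ne_zero 0)
    (hμ x (Submodule.subset_span (by simp)))
  exact ⟨μ, hroot, hℓ.1.eq_of_le (hb.isLn_eigenspace hroot)
    fun z hz => mem_ker_sub_smul.2 (hμ z hz)⟩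

theorem moved_of_no_root (h : ∀ μ : F, μ ^ 2 + μ + 1 ≠ 0) {x : U} (hx : x ≠ 0) :
    ∀ μ : F, s x ≠ μ • x := fun μ hμ => h μ (hb.eigenvalue_sq_add hx hμ)

/-- The two vectors spanning the eigenspace have determinant `(1 - μ s)²`, with components `1 - μ²`
and `1 - μ`. Both vanish exactly when `μ = 1`, and `1` is a root of `X² + X + 1` only if `3 = 0`. -/
theorem eigenspace_mem_detCongruence_iff {μ : F} (hμ : μ ^ 2 + μ + 1 = 0) :
    LinearMap.ker (s - μ • LinearMap.id) ∈ detCongruence b ↔ (3 : F) = 0 := by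
  have h1 : detForm₁ b (b 0 - μ • b 2) (b 1 - μ • b 3) = 1 - μ ^ 2 := by
    simp [detForm₁_apply]; ring
  have h2 : detForm₂ b (b 0 - μ • b 2) (b 1 - μ • b 3) = 1 - μ := by
    simp [detForm₂_apply]; linear_combination -hμ
  constructor
  · intro h
    rw [hb.eigenspace_eq_span hμ] at h
    have := (h.2 _ (Submodule.subset_span (Set.mem_insert _ _)) (b 1 - μ • b 3)
      (Submodule.subset_span (by simp))).2
    rw [h2] at this
    linear_combination hμ + (μ + 2) * this
  · intro h3
    have : μ = 1 := by
      have : (μ - 1) ^ 2 = 0 := by linear_combination hμ - μ * h3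
      exact sub_eq_zero.1 (pow_eq_zero_iff two_ne_zero |>.1 this)
    refine mem_detCongruence_of_span (hb.isLn_eigenspace hμ) (hb.eigenspace_eq_span hμ) ?_ ?_
    · rw [h1, this]; ring
    · rw [h2, this]; ring

theorem movedLines_eq_detCongruence (h : (3 : F) ≠ 0) : movedLines s = detCongruence b := by
  refine hb.movedLines_subset_detCongruence.antisymm fun ℓ hℓ => ?_
  refine (hb.mem_movedLines_or_eigenLines hℓ).resolve_right fun h' => ?_
  obtain ⟨μ, hμ, rfl⟩ := hb.exists_eq_eigenspace h'
  exact h ((hb.eigenspace_mem_detCongruence_iff hμ).1 hℓ)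

/-- Since `X² + X + 1 = (X - μ)(X + 1 + μ)`, the map `s + 1 + μ` sends every vector into the
eigenspace, and it does not kill a moved vector. -/
theorem meets_eigenspace {μ : F} (hμ : μ ^ 2 + μ + 1 = 0) {ℓ : Submodule F U}
    (hℓ : ℓ ∈ movedLines s) : Meets ℓ (LinearMap.ker (s - μ • LinearMap.id)) := by
  obtain ⟨-, hinv, x, hx, hne⟩ := hℓ
  refine meets_iff.2 ⟨s x + (1 + μ) • x, ℓ.add_mem (hinv x hx) (ℓ.smul_mem _ hx), ?_, ?_⟩
  · rw [mem_ker_sub_smul, map_add, map_smul, hb.map_map, ← sub_eq_zero]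
    have : -x - s x + (1 + μ) • s x - μ • (s x + (1 + μ) • x) = -(μ ^ 2 + μ + 1) • x := by module
    rw [this, hμ, neg_zero, zero_smul]
  · intro h0
    exact hne (-(1 + μ)) (by rw [eq_neg_of_add_eq_zero_left h0, neg_smul])

theorem isEllipticCongruence (h : ∀ μ : F, μ ^ 2 + μ + 1 ≠ 0) :
    IsEllipticCongruence (movedLines s) := by
  have hmv : ∀ {x : U}, x ≠ 0 → ∀ μ : F, s x ≠ μ • x := hb.moved_of_no_root h
  have h3 : (3 : F) ≠ 0 := fun h3 => h 1 (by linear_combination h3)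
  refine ⟨hb.movedLines_eq_detCongruence h3 ▸ isLinearCongruence_detCongruence b,
    ⟨fun ℓ hℓ => hℓ.1, fun P hP => ?_⟩, ?_⟩
  · obtain ⟨x, hx, rfl⟩ := hP.exists_eq_span
    refine ⟨_, ⟨span_mem_movedLines hb.map_map (hmv hx),
      Submodule.span_mono (by simp)⟩, fun ℓ hℓ => ?_⟩
    have hxl := hℓ.2 (Submodule.mem_span_singleton_self x)
    exact eq_span_of_moved hℓ.1.1 (hmv hx) hxl (hℓ.1.2.1 x hxl)
  · intro a ha c hc d hd hac had hcd m hm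
    have hdisj : ∀ {a c : Submodule F U}, a ∈ movedLines s → c ∈ movedLines s → a ≠ c →
        ∀ z ∈ a, z ∈ c → z = 0 := fun ha hc hac z hza hzc => by
      by_contra hz
      exact hac ((eq_span_of_moved ha.1 (hmv hz) hza (ha.2.1 z hza)).trans
        (eq_span_of_moved hc.1 (hmv hz) hzc (hc.2.1 z hzc)).symm)
    have htop : a ⊔ c = ⊤ := by
      have : Module.Finite F U := Module.Finite.of_basis b
      have hfr : Module.finrank F U = 4 := by simpa using Module.finrank_eq_card_basis b
      refine Submodule.eq_top_of_disjoint a c ?_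
        (Submodule.disjoint_def.2 (hdisj ha hc hac))
      have h1 : Module.finrank F a = 2 := ha.1
      have h2 : Module.finrank F c = 2 := hc.1
      omega
    obtain ⟨z, hzd, -, hz0⟩ : ∃ z ∈ d, z ∈ (⊤ : Submodule F U) ∧ z ≠ 0 := by
      obtain ⟨z, y, hzy, rfl⟩ := hd.1.exists_basis
      exact ⟨z, Submodule.subset_span (by simp), trivial, by simpa using hzy.ne_zero 0⟩
    -- Now `a`, `c`, `d` are generated over `F[s]` by `x`, `y`, `x + y`. For `r = 1, s, 1 + s` the
    -- line `⟨r x, r y⟩` is a transversal, and a line meeting these three is invariant.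
    obtain ⟨x, hx, y, hy, rfl⟩ := Submodule.mem_sup.1 (htop ▸ Submodule.mem_top : z ∈ a ⊔ c)
    have hx0 : x ≠ 0 := by
      rintro rfl
      exact hz0 (hdisj hc hd hcd _ (by simpa using hy) hzd)
    have hy0 : y ≠ 0 := by
      rintro rfl
      exact hz0 (hdisj ha hd had _ (by simpa using hx) hzd)
    have hsx := ha.2.1 x hx
    have hsy := hc.2.1 y hy
    have hsd := hd.2.1 _ hzd
    have hind : ∀ p q p' q' : F, p • x + q • y + p' • s x + q' • s y = 0 →
        p = 0 ∧ q = 0 ∧ p' = 0 ∧ q' = 0 := fun p q p' q' h0 => by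
      have e : p • x + p' • s x = -(q • y + q' • s y) := by
        rw [eq_neg_iff_add_eq_zero, ← h0]; module
      have e0 : p • x + p' • s x = 0 := hdisj ha hc hac _
        (a.add_mem (a.smul_mem _ hx) (a.smul_mem _ hsx))
        (e ▸ c.neg_mem (c.add_mem (c.smul_mem _ hy) (c.smul_mem _ hsy)))
      rw [e0, zero_eq_neg] at e
      obtain ⟨r1, r2⟩ := LinearIndependent.pair_iff.1
        (linearIndependent_of_moved (hmv hx0)) _ _ e0
      obtain ⟨r3, r4⟩ := LinearIndependent.pair_iff.1
        (linearIndependent_of_moved (hmv hy0)) _ _ e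
      exact ⟨r1, r3, r2, r4⟩
    refine mem_movedLines_of_meets hb.map_map hind hm.1 (hm.2 _ ?_) (hm.2 _ ?_) (hm.2 _ ?_)
    · refine span_mem_transversals hx hy hzd (LinearIndependent.pair_iff.2 fun p q h0 => ?_)
      obtain ⟨r1, r2, -⟩ := hind p q 0 0 (by rw [← h0]; module)
      exact ⟨r1, r2⟩
    · refine span_mem_transversals hsx hsy (by rwa [← map_add])
        (LinearIndependent.pair_iff.2 fun p q h0 => ?_)
      obtain ⟨-, -, r1, r2⟩ := hind 0 0 p q (by rw [← h0]; module)
      exact ⟨r1, r2⟩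
    · refine span_mem_transversals (a.add_mem hx hsx) (c.add_mem hy hsy) ?_
        (LinearIndependent.pair_iff.2 fun p q h0 => ?_)
      · rw [add_add_add_comm, ← map_add]
        exact d.add_mem hzd hsd
      · obtain ⟨r1, r2, -⟩ := hind p q p q (by rw [← h0]; module)
        exact ⟨r1, r2⟩

theorem eigenLines_eq_pair {μ : F} (hμ : μ ^ 2 + μ + 1 = 0) :
    eigenLines s = {LinearMap.ker (s - μ • LinearMap.id),
      LinearMap.ker (s - (-1 - μ) • LinearMap.id)} := by
  have hμ' : (-1 - μ) ^ 2 + (-1 - μ) + 1 = 0 := by linear_combination hμ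
  refine Set.Subset.antisymm (fun ℓ hℓ => ?_) ?_
  · obtain ⟨ν, hν, rfl⟩ := hb.exists_eq_eigenspace hℓ
    have : (ν - μ) * (ν - (-1 - μ)) = 0 := by linear_combination hν - hμ
    rcases mul_eq_zero.1 this with h | h
    · rw [sub_eq_zero.1 h]; exact .inl rfl
    · rw [sub_eq_zero.1 h]; exact .inr rfl
  · rintro ℓ (rfl | rfl)
    · exact hb.eigenspace_mem_eigenLines hμ
    · exact hb.eigenspace_mem_eigenLines hμ'

omit hb in
theorem disjoint_eigenspaces {μ ν : F} (h : μ ≠ ν) :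
    Disjoint (LinearMap.ker (s - μ • LinearMap.id)) (LinearMap.ker (s - ν • LinearMap.id)) := by
  refine Submodule.disjoint_def.2 fun x hx hx' => ?_
  rw [mem_ker_sub_smul] at hx hx'
  have : (μ - ν) • x = 0 := by rw [sub_smul, ← hx, ← hx', sub_self]
  exact (smul_eq_zero.1 this).resolve_left (sub_ne_zero.2 h)

theorem exists_isHyperbolicCongruence (h3 : (3 : F) ≠ 0) {μ : F} (hμ : μ ^ 2 + μ + 1 = 0) :
    ∃ ℓ₁ ℓ₂ : Submodule F U, ℓ₁ ≠ ℓ₂ ∧ eigenLines s = {ℓ₁, ℓ₂} ∧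
      IsHyperbolicCongruence (movedLines s) ℓ₁ ℓ₂ := by
  have hμ' : (-1 - μ) ^ 2 + (-1 - μ) + 1 = 0 := by linear_combination hμ
  -- The discriminant of `X² + X + 1` is `-3`, so its roots differ.
  have hne : μ ≠ -1 - μ := fun h => h3 (by
    linear_combination 4 * hμ - (2 * μ + 1) * h)
  have hdisj := disjoint_eigenspaces (s := s) hne
  have hl1 := hb.isLn_eigenspace hμ
  have hl2 := hb.isLn_eigenspace hμ'
  refine ⟨_, _, fun heq => ?_, hb.eigenLines_eq_pair hμ,
    hb.movedLines_eq_detCongruence h3 ▸ isLinearCongruence_detCongruence b, hl1, hl2, hdisj, ?_⟩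
  · rw [heq, disjoint_self] at hdisj
    rw [IsLn, hdisj, finrank_bot] at hl2
    omega
  refine Set.Subset.antisymm
    (fun m hm => ⟨hm.1, hb.meets_eigenspace hμ hm, hb.meets_eigenspace hμ' hm⟩) ?_
  rintro m ⟨hm, hm1, hm2⟩
  obtain ⟨x, hxm, hx, hx0⟩ := meets_iff.1 hm1
  obtain ⟨y, hym, hy, hy0⟩ := meets_iff.1 hm2
  have hxy : LinearIndependent F ![x, y] := (LinearIndependent.pair_iff' hx0).2 fun k hk =>
    hy0 (Submodule.disjoint_def.1 hdisj y (hk ▸ Submodule.smul_mem _ k hx) hy)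
  rw [mem_ker_sub_smul] at hx hy
  -- A sum of eigenvectors for different eigenvalues is not an eigenvector.
  refine ⟨hm, fun z hz => ?_, x + y, m.add_mem hxm hym, fun ν hν => ?_⟩
  · rw [hm.eq_span_pair hxm hym hxy] at hz
    obtain ⟨p, q, rfl⟩ := Submodule.mem_span_pair.1 hz
    rw [map_add, map_smul, map_smul, hx, hy]
    exact m.add_mem (m.smul_mem _ (m.smul_mem _ hxm)) (m.smul_mem _ (m.smul_mem _ hym))
  · obtain ⟨h1, h2⟩ := LinearIndependent.pair_iff.1 hxy (μ - ν) (-1 - μ - ν) (by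
      rw [map_add, hx, hy, ← sub_eq_zero] at hν
      rw [← hν]; module)
    exact hne ((sub_eq_zero.1 h1).trans (sub_eq_zero.1 h2).symm)

/-- Now `X² + X + 1 = (X - 1)²`, so the axis is the only eigenspace, and it lies in the determinant
congruence. Moved lines sharing a vector `x` off the axis both equal `⟨x, s x⟩`. -/
theorem exists_isParabolicCongruence [Finite F] (h3 : (3 : F) = 0) :
    ∃ ℓ : Submodule F U, eigenLines s = {ℓ} ∧
      IsParabolicCongruence (insert ℓ (movedLines s)) ℓ := by
  have h1 : (1 : F) ^ 2 + 1 + 1 = 0 := by linear_combination h3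
  set ℓ := LinearMap.ker (s - (1 : F) • LinearMap.id) with hℓ
  have heig : eigenLines s = {ℓ} := by
    rw [hb.eigenLines_eq_pair h1, show (-1 - 1 : F) = 1 by linear_combination -h3,
      Set.pair_eq_singleton]
  have hℓe : ℓ ∈ eigenLines s := hb.eigenspace_mem_eigenLines h1
  have hℓm : ℓ ∉ movedLines s := fun h => movedLines_disjoint_eigenLines h hℓe
  have hC : insert ℓ (movedLines s) = detCongruence b := by
    refine Set.Subset.antisymm (Set.insert_subset
      ((hb.eigenspace_mem_detCongruence_iff h1).2 h3) hb.movedLines_subset_detCongruence)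
      fun m hm => ?_
    rcases hb.mem_movedLines_or_eigenLines hm with h | h
    · exact .inr h
    · rw [heig] at h; exact .inl h
  have hdiff : insert ℓ (movedLines s) \ {ℓ} = movedLines s := by
    rw [Set.insert_sdiff_of_mem _ (Set.mem_singleton ℓ), Set.sdiff_singleton_eq_self hℓm]
  have hmv : ∀ {x : U}, x ∉ ℓ → ∀ μ : F, s x ≠ μ • x := fun {x} hx μ hμ => by
    have h0 : x ≠ 0 := by rintro rfl; exact hx ℓ.zero_mem
    have hr := hb.eigenvalue_sq_add h0 hμ
    have : (μ - 1) ^ 2 = 0 := by linear_combination hr - μ * h3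
    rw [sub_eq_zero.1 (pow_eq_zero_iff two_ne_zero |>.1 this)] at hμ
    exact hx (mem_ker_sub_smul.2 hμ)
  refine ⟨ℓ, heig, ?_⟩
  unfold IsParabolicCongruence
  rw [hdiff]
  refine ⟨hC ▸ isLinearCongruence_detCongruence b, hℓe.1, Set.mem_insert _ _, ?_,
    fun m hm => ⟨hm.1, hb.meets_eigenspace h1 hm⟩, fun m hm m' hm' hne => .inr ?_, ?_⟩
  · have : Module.Finite F U := Module.Finite.of_basis b
    exact ncard_movedLines hb.map_map (by simpa using Module.finrank_eq_card_basis b) hℓe.1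
      (fun x hx => hmv hx) (fun m hm => hb.meets_eigenspace h1 hm) hℓm
  · rintro x ⟨hx, hx'⟩
    by_contra hxl
    exact hne ((eq_span_of_moved hm.1 (hmv hxl) hx (hm.2.1 x hx)).trans
      (eq_span_of_moved hm'.1 (hmv hxl) hx' (hm'.2.1 x hx')).symm)
  · have hind : ∀ p q p' q' : F, p • b 0 + q • b 1 + p' • s (b 0) + q' • s (b 1) = 0 →
        p = 0 ∧ q = 0 ∧ p' = 0 ∧ q' = 0 := fun p q p' q' h0 => by
      rw [hb.map0, hb.map1] at h0
      have c0 := congrArg (b.coord 0) h0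
      have c1 := congrArg (b.coord 1) h0
      have c2 := congrArg (b.coord 2) h0
      have c3 := congrArg (b.coord 3) h0
      simp at c0 c1 c2 c3
      exact ⟨c0, c1, c2, c3⟩
    -- The regulus consists of the transversals of `⟨r b₀, r b₁⟩` for `r = 1, s, 1 + s`.
    refine ⟨_, fun t ht => mem_movedLines_of_meets hb.map_map hind ht.1 ht.2.1 ht.2.2.1 ht.2.2.2,
      _, _, _, ?_, ?_, ?_, ?_, ?_, ?_, rfl⟩
    · refine isLn_span_pair (LinearIndependent.pair_iff.2 fun p q h0 => ?_)
      obtain ⟨r1, r2, -⟩ := hind p q 0 0 (by rw [← h0]; module)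
      exact ⟨r1, r2⟩
    · refine isLn_span_pair (LinearIndependent.pair_iff.2 fun p q h0 => ?_)
      obtain ⟨-, -, r1, r2⟩ := hind 0 0 p q (by rw [← h0]; module)
      exact ⟨r1, r2⟩
    · refine isLn_span_pair (LinearIndependent.pair_iff.2 fun p q h0 => ?_)
      obtain ⟨r1, r2, -⟩ := hind p q p q (by rw [← h0]; module)
      exact ⟨r1, r2⟩
    · refine Submodule.disjoint_def.2 fun z hz hz' => ?_
      obtain ⟨p, q, rfl⟩ := Submodule.mem_span_pair.1 hz
      obtain ⟨p', q', h⟩ := Submodule.mem_span_pair.1 hz'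
      obtain ⟨r1, r2, -⟩ := hind p q (-p') (-q') (by
        rw [eq_comm, ← sub_eq_zero] at h; rw [← h]; module)
      simp [r1, r2]
    · refine Submodule.disjoint_def.2 fun z hz hz' => ?_
      obtain ⟨p, q, rfl⟩ := Submodule.mem_span_pair.1 hz
      obtain ⟨p', q', h⟩ := Submodule.mem_span_pair.1 hz'
      obtain ⟨r1, r2, r3, r4⟩ := hind (p - p') (q - q') (-p') (-q') (by
        rw [eq_comm, ← sub_eq_zero] at h; rw [← h]; module)
      rw [neg_eq_zero] at r3 r4
      rw [r3, sub_zero] at r1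
      rw [r4, sub_zero] at r2
      simp [r1, r2]
    · refine Submodule.disjoint_def.2 fun z hz hz' => ?_
      obtain ⟨p, q, rfl⟩ := Submodule.mem_span_pair.1 hz
      obtain ⟨p', q', h⟩ := Submodule.mem_span_pair.1 hz'
      obtain ⟨r1, r2, r3, r4⟩ := hind (-p') (-q') (p - p') (q - q') (by
        rw [eq_comm, ← sub_eq_zero] at h; rw [← h]; module)
      rw [neg_eq_zero] at r1 r2
      rw [r1, sub_zero] at r3
      rw [r2, sub_zero] at r4
      simp [r3, r4]

end IsOrderThreeBasis
end Abstract

/-! ### Elements of trace zero in a cubic extension -/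

section CubicField

variable {F K : Type*} [Field F] [Finite F] [Field K] [Algebra F K]

omit [Finite F] in
theorem mem_range_algebraMap_of_fixed (hK : Module.finrank F K = 3) {τ : K →ₐ[F] K}
    (hτ : τ ≠ AlgHom.id F K) {x : K} (hx : τ x = x) : ∃ a : F, algebraMap F K a = x := by
  have : IsSimpleOrder (Subalgebra F K) :=
    Subalgebra.isSimpleOrder_of_finrank_prime F K (by rw [hK]; exact Nat.prime_three)
  have hmem : x ∈ AlgHom.equalizer τ (AlgHom.id F K) := hx
  rcases eq_bot_or_eq_top (AlgHom.equalizer τ (AlgHom.id F K)) with h | h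
  · rw [h] at hmem
    exact Algebra.mem_bot.1 hmem
  · exact absurd (AlgHom.ext fun y => (h ▸ Algebra.mem_top : y ∈ AlgHom.equalizer _ _)) hτ

theorem map_map_map_of_cubic (hK : Module.finrank F K = 3) (τ : K →ₐ[F] K) (x : K) :
    τ (τ (τ x)) = x := by
  have : FiniteDimensional F K := FiniteDimensional.of_finrank_pos (by omega)
  have : Finite K := Module.finite_of_finite F
  let e : K ≃ₐ[F] K := AlgEquiv.ofBijective τ τ.bijective
  have h : e ^ 3 = 1 := by
    rw [← hK, ← IsGalois.card_aut_eq_finrank F K]; exact pow_card_eq_one'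
  exact AlgEquiv.congr_fun h x

omit [Finite F] in
-- The product is the value at `θ` of `(X - τ θ)(X - τ² θ)`, which vanishes at the other two
-- conjugates. It serves to isolate one term of a trace.
theorem exists_moved_element {τ : K →ₐ[F] K} (hτ : τ ≠ AlgHom.id F K)
    (h3 : ∀ x, τ (τ (τ x)) = x) : ∃ θ : K, (θ - τ θ) * (θ - τ (τ θ)) ≠ 0 := by
  by_contra! h
  refine hτ (AlgHom.ext fun x => ?_)
  rcases mul_eq_zero.1 (h x) with h | h
  · exact (sub_eq_zero.1 h).symm
  · have := congrArg τ (sub_eq_zero.1 h)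
    rwa [h3] at this

/-- The elements of trace zero. -/
def traceZero (τ : K →ₐ[F] K) : Submodule F K :=
  LinearMap.ker (LinearMap.id + τ.toLinearMap + τ.toLinearMap ∘ₗ τ.toLinearMap)

omit [Finite F] in
theorem mem_traceZero {τ : K →ₐ[F] K} {x : K} : x ∈ traceZero τ ↔ x + τ x + τ (τ x) = 0 :=
  Iff.rfl

omit [Finite F] in
theorem range_sub_id_le_traceZero {τ : K →ₐ[F] K} (h3 : ∀ x, τ (τ (τ x)) = x) :
    LinearMap.range (τ.toLinearMap - LinearMap.id) ≤ traceZero τ := by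
  rintro _ ⟨x, rfl⟩
  simp [mem_traceZero, h3]

omit [Finite F] in
theorem finrank_ker_sub_id (hK : Module.finrank F K = 3) {τ : K →ₐ[F] K}
    (hτ : τ ≠ AlgHom.id F K) :
    Module.finrank F (LinearMap.ker (τ.toLinearMap - LinearMap.id)) = 1 := by
  refine finrank_eq_one (v := ⟨1, by simp⟩) (by simp) fun w => ?_
  obtain ⟨a, ha⟩ := mem_range_algebraMap_of_fixed hK hτ (sub_eq_zero.1 w.2)
  exact ⟨a, Subtype.ext (by simp [← ha, Algebra.smul_def])⟩

/-- The map `τ - 1` has kernel `F`, so its image has dimension two; it lies in the trace-zero space,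
which is proper because the trace is not identically zero. -/
theorem isLn_traceZero (hK : Module.finrank F K = 3) {τ : K →ₐ[F] K}
    (hτ : τ ≠ AlgHom.id F K) :
    IsLn (traceZero τ) ∧ LinearMap.range (τ.toLinearMap - LinearMap.id) = traceZero τ := by
  have : FiniteDimensional F K := FiniteDimensional.of_finrank_pos (by omega)
  have h3 := map_map_map_of_cubic hK τ
  have hle := range_sub_id_le_traceZero h3
  have hrk := LinearMap.finrank_range_add_finrank_ker (τ.toLinearMap - LinearMap.id)
  rw [hK, finrank_ker_sub_id hK hτ] at hrk
  have hlt : Module.finrank F (traceZero τ) < 3 := by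
    rw [← hK]
    refine Submodule.finrank_lt fun htop => ?_
    have hall : ∀ x : K, x + τ x + τ (τ x) = 0 := fun x =>
      mem_traceZero.1 (htop ▸ Submodule.mem_top)
    obtain ⟨θ, hθ⟩ := exists_moved_element hτ h3
    -- The traces of `1`, `θ`, `θ²`, weighted by the coefficients of `(X - τ θ)(X - τ² θ)`, add up
    -- to the value at `θ`.
    have h0 := hall 1
    have h1 := hall θ
    have h2 := hall (θ ^ 2)
    simp only [map_one, map_pow] at h0 h2
    exact hθ (by linear_combination h2 - (τ θ + τ (τ θ)) * h1 + τ θ * τ (τ θ) * h0)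
  have hge := Submodule.finrank_mono hle
  have h2 : Module.finrank F (traceZero τ) = 2 := by omega
  exact ⟨h2, Submodule.eq_of_le_of_finrank_eq hle (by omega)⟩

/-- If `τ` were scalar on the trace-zero elements, the quotient of two of them would be fixed by
`τ`, hence in `F`, and they could not span a plane over `F`. -/
theorem exists_traceZero_basis (hK : Module.finrank F K = 3) {τ : K →ₐ[F] K}
    (hτ : τ ≠ AlgHom.id F K) :
    ∃ t : K, t + τ t + τ (τ t) = 0 ∧ LinearIndependent F ![t, τ t] ∧
      ∀ x : K, x + τ x + τ (τ x) = 0 → ∃ a d : F, x = a • t + d • τ t := by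
  have h3 := map_map_map_of_cubic hK τ
  obtain ⟨hT, -⟩ := isLn_traceZero hK hτ
  have hinv : ∀ x ∈ traceZero τ, τ x ∈ traceZero τ := fun x hx => by
    rw [mem_traceZero] at hx ⊢
    rw [h3]; linear_combination hx
  obtain ⟨t, ht, hne⟩ : ∃ t ∈ traceZero τ, ∀ μ : F, τ.toLinearMap t ≠ μ • t := by
    by_contra! h
    obtain ⟨μ, hμ⟩ := exists_eigenvalue h
    obtain ⟨x, y, hxy, hsp⟩ := hT.exists_basis
    have hx : x ∈ traceZero τ := hsp ▸ Submodule.subset_span (by simp)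
    have hy : y ∈ traceZero τ := hsp ▸ Submodule.subset_span (by simp)
    have hx0 : x ≠ 0 := by simpa using hxy.ne_zero 0
    have h1 : τ x = μ • x := hμ x hx
    have h2 : τ y = μ • y := hμ y hy
    have hμ0 : algebraMap F K μ ≠ 0 := fun h0 => by
      rw [Algebra.smul_def, h0, zero_mul] at h1
      exact hx0 ((map_eq_zero τ).1 h1)
    obtain ⟨a, ha⟩ := mem_range_algebraMap_of_fixed hK hτ (x := y / x) (by
      rw [map_div₀, h1, h2, Algebra.smul_def, Algebra.smul_def, mul_div_mul_left _ _ hμ0])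
    refine (LinearIndependent.pair_iff' hx0).1 hxy a ?_
    rw [Algebra.smul_def, ha, div_mul_cancel₀ _ hx0]
  have ht0 : t ≠ 0 := by rintro rfl; exact hne 0 (by simp)
  have hli : LinearIndependent F ![t, τ t] :=
    (LinearIndependent.pair_iff' ht0).2 fun a ha => hne a ha.symm
  refine ⟨t, ht, hli, fun x hx => ?_⟩
  have hx' : x ∈ traceZero τ := hx
  rw [hT.eq_span_pair ht (hinv t ht) hli] at hx'
  obtain ⟨a, d, h⟩ := Submodule.mem_span_pair.1 hx'
  exact ⟨a, d, h.symm⟩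

end CubicField

/-! ### From the collineation to a semilinear map -/

section FieldReduction

variable {F K V : Type*} [Field F] [Field K] [Algebra F K] [AddCommGroup V] [Module F V]
  [Module K V] [IsScalarTower F K V]

theorem Induces.map_mem {φ : Submodule K V ≃o Submodule K V} {σ : V ≃ₗ[F] V}
    (hσ : Induces φ σ) {X : Submodule K V} {x : V} (hx : x ∈ X) : σ x ∈ φ X := by
  have : σ x ∈ (φ X).restrictScalars F := by
    rw [← hσ X]; exact Submodule.mem_map_of_mem (f := (σ : V →ₗ[F] V)) hx
  exact this

theorem Induces.map_span_singleton {φ : Submodule K V ≃o Submodule K V} {σ : V ≃ₗ[F] V}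
    (hσ : Induces φ σ) (v : V) :
    φ (Submodule.span K {v}) = Submodule.span K {σ v} := by
  by_cases hv : v = 0
  · rw [hv, map_zero, Submodule.span_zero_singleton, map_bot]
  · have hat : IsAtom (φ (Submodule.span K {v})) :=
      (OrderIso.isAtom_iff φ _).2 (nonzero_span_atom v hv)
    have hle : Submodule.span K {σ v} ≤ φ (Submodule.span K {v}) := by
      rw [Submodule.span_singleton_le_iff_mem]
      exact hσ.map_mem (Submodule.mem_span_singleton_self v)
    refine ((hat.le_iff.1 hle).resolve_left fun h => hv ?_).symm
    rw [Submodule.span_singleton_eq_bot] at h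
    exact σ.map_eq_zero_iff.1 h

/-- A linear map that induces a collineation fixing a subplane over `F` pointwise is semilinear
over `K`. -/
theorem Induces.exists_semilinear {φ : Submodule K V ≃o Submodule K V} (hφ : φ ≠ 1)
    (hfix : FixesSubplane F φ) {σ : V ≃ₗ[F] V} (hσ : Induces φ σ) :
    ∃ (b : Module.Basis (Fin 3) K V) (τ : K →ₐ[F] K) (c : K), τ ≠ AlgHom.id F K ∧ c ≠ 0 ∧
      (∀ (k : K) (v : V), σ (k • v) = τ k • σ v) ∧ ∀ i, σ (b i) = c • b i := by
  obtain ⟨b, hb⟩ := hfix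
  have hspan : ∀ v ∈ Submodule.span F (Set.range b), ∀ k : K, ∃ l : K, σ (k • v) = l • v := by
    intro v hv k
    have h1 := hσ.map_mem (Submodule.smul_mem _ k (Submodule.mem_span_singleton_self (R := K) v))
    rw [hb v hv] at h1
    obtain ⟨l, hl⟩ := Submodule.mem_span_singleton.1 h1
    exact ⟨l, hl.symm⟩
  have hbi : ∀ i, b i ∈ Submodule.span F (Set.range b) := fun i =>
    Submodule.subset_span (Set.mem_range_self i)
  let g : K →ₗ[F] K := (b.coord 0).restrictScalars F ∘ₗ (σ : V →ₗ[F] V) ∘ₗ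
    (LinearMap.toSpanSingleton K V (b 0)).restrictScalars F
  have hg : ∀ k, g k = b.coord 0 (σ (k • b 0)) := fun k => rfl
  have hg0 : ∀ k, σ (k • b 0) = g k • b 0 := fun k => by
    obtain ⟨l, hl⟩ := hspan _ (hbi 0) k
    rw [hg, hl]; simp
  -- The point of `b 0 + b i` is also fixed, which forces the same `g` on every axis.
  have hgi : ∀ k i, σ (k • b i) = g k • b i := fun k i => by
    by_cases hi : i = 0
    · rw [hi, hg0]
    obtain ⟨l, hl⟩ := hspan _ (hbi i) k
    obtain ⟨l', hl'⟩ := hspan _ (Submodule.add_mem _ (hbi 0) (hbi i)) k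
    rw [smul_add, map_add, hg0, hl, smul_add] at hl'
    have e0 := congrArg (b.coord 0) hl'
    have ei := congrArg (b.coord i) hl'
    simp [hi, Ne.symm hi] at e0 ei
    rw [hl, e0, ei]
  have hc : g 1 ≠ 0 := fun h => b.ne_zero 0 (σ.injective (by
    have := hg0 1
    rwa [h, zero_smul, one_smul, ← map_zero σ] at this))
  -- The image of `x (b 0 + k b 1)` is a `K`-multiple of the image of `b 0 + k b 1`; comparing
  -- coordinates makes `g / g 1` multiplicative.
  have hmul : ∀ x k, g (x * k) * g 1 = g x * g k := fun x k => by
    have h1 := hσ.map_mem (Submodule.smul_mem _ x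
      (Submodule.mem_span_singleton_self (R := K) (b 0 + k • b 1)))
    rw [hσ.map_span_singleton] at h1
    obtain ⟨l, hl⟩ := Submodule.mem_span_singleton.1 h1
    have h0 : σ (b 0) = g 1 • b 0 := by rw [← hg0, one_smul]
    rw [map_add, h0, hgi, smul_add, smul_add x, map_add, hg0, smul_smul x, hgi] at hl
    have e0 := congrArg (b.coord 0) hl
    have e1 := congrArg (b.coord 1) hl
    simp at e0 e1
    rw [← e0, ← e1]; ring
  let τ : K →ₐ[F] K := AlgHom.ofLinearMap ((LinearMap.mulLeft F (g 1)⁻¹) ∘ₗ g)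
    (by simp [hc]) (fun x y => by
      simp only [LinearMap.comp_apply, LinearMap.mulLeft_apply]
      field_simp
      rw [mul_comm, hmul x y])
  have hτ : ∀ k, g k = τ k * g 1 := fun k => by
    change g k = (g 1)⁻¹ * g k * g 1
    field_simp
  have hsemi : ∀ (k : K) (v : V), σ (k • v) = τ k • σ v := fun k v => by
    rw [← b.sum_repr v, Finset.smul_sum, map_sum, map_sum, Finset.smul_sum]
    refine Finset.sum_congr rfl fun i _ => ?_
    rw [smul_smul, hgi, hgi, smul_smul, hτ, map_mul, hτ (b.repr v i), mul_assoc]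
  have hbc : ∀ i, σ (b i) = g 1 • b i := fun i => by rw [← hgi, one_smul]
  refine ⟨b, τ, g 1, fun hid => hφ ?_, hc, hsemi, hbc⟩
  -- If `τ` were the identity, `σ` would be a `K`-scalar and `φ` trivial.
  have hsc : ∀ v, σ v = g 1 • v := fun v => by
    rw [← b.sum_repr v, map_sum, Finset.smul_sum]
    refine Finset.sum_congr rfl fun i _ => ?_
    rw [hsemi, hbc, hid, AlgHom.id_apply, smul_comm]
  refine RelIso.ext fun X => le_antisymm (fun y hy => ?_) fun y hy => ?_
  · have : y ∈ (X.restrictScalars F).map (σ : V →ₗ[F] V) := by rw [hσ X]; exact hy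
    obtain ⟨x, hx, rfl⟩ := this
    exact (hsc x).symm ▸ X.smul_mem _ hx
  · have h := (φ X).smul_mem (g 1)⁻¹ (hσ.map_mem hy)
    rwa [hsc, inv_smul_smul₀ hc] at h

end FieldReduction

/-! ### The hwise-fixed 5-space as the vectors of trace zero -/

section FieldReduction

variable {F K V : Type*} [Field F] [Field K] [Algebra F K] [AddCommGroup V] [Module F V]
  [Module K V] [IsScalarTower F K V]

/-- Modulo a hwise-fixed 5-space, `σ` is a scalar. -/
theorem IsHwiseFixed5Space.exists_scalar [FiniteDimensional F V] (hV : Module.finrank F V = 9)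
    {σ : V ≃ₗ[F] V} {W : Submodule F V} (hW : IsHwiseFixed5Space σ W) :
    ∃ μ : F, ∀ v, σ v - μ • v ∈ W := by
  let d : Module.Dual F V →ₗ[F] Module.Dual F V := (σ : V →ₗ[F] V).dualMap
  -- Hyperplanes through `W` are kernels of functionals that vanish on `W`; such a hyperplane being
  -- fixed makes its functional an eigenvector of the dual map.
  have hd : ∀ f ∈ W.dualAnnihilator, ∃ μ : F, d f = μ • f := by
    intro f hf
    by_cases hf0 : f = 0
    · exact ⟨0, by simp [hf0]⟩
    obtain ⟨v, hv⟩ : ∃ v, f v ≠ 0 := by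
      by_contra! h
      exact hf0 (LinearMap.ext h)
    have hrk : Module.finrank F (LinearMap.ker f) = 8 := by
      have h1 := LinearMap.finrank_range_add_finrank_ker f
      rw [LinearMap.range_eq_top.2 (LinearMap.surjective_of_ne_zero hf0), finrank_top,
        Module.finrank_self, hV] at h1
      omega
    have hfix := hW.2 _ hrk fun w hw => (Submodule.mem_dualAnnihilator f).1 hf w hw
    have hker : ∀ x, f x = 0 → f (σ x) = 0 := fun x hx => by
      have : σ x ∈ (LinearMap.ker f).map (σ : V →ₗ[F] V) :=
        Submodule.mem_map_of_mem (f := (σ : V →ₗ[F] V)) hx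
      rw [hfix] at this
      exact this
    refine ⟨f (σ v) / f v, LinearMap.ext fun x => ?_⟩
    have h0 := hker (x - (f x / f v) • v) (by simp [hv])
    rw [map_sub, map_smul, map_sub, map_smul, smul_eq_mul, sub_eq_zero] at h0
    change f (σ x) = f (σ v) / f v * f x
    rw [h0]; ring
  obtain ⟨μ, hμ⟩ := exists_eigenvalue hd
  refine ⟨μ, fun v => ?_⟩
  rw [← Subspace.forall_mem_dualAnnihilator_apply_eq_zero_iff]
  intro f hf
  have : f (σ v) = μ • f v := LinearMap.congr_fun (hμ f hf) v
  rw [map_sub, map_smul, this, sub_self]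

/-- `s` is the coordinatewise action of `τ` with respect to some `K`-basis of `V`. -/
structure IsCoordinatewise (τ : K →ₐ[F] K) (s : V →ₗ[F] V) : Prop where
  map_smul' : ∀ (k : K) (v : V), s (k • v) = τ k • s v
  exists_basis : ∃ b : Module.Basis (Fin 3) K V, ∀ i, s (b i) = b i

omit [IsScalarTower F K V] in
theorem IsCoordinatewise.map_eq_sum {τ : K →ₐ[F] K} {s : V →ₗ[F] V}
    (hs : IsCoordinatewise τ s) {b : Module.Basis (Fin 3) K V} (hb : ∀ i, s (b i) = b i) (v : V) :
    s v = ∑ i, τ (b.repr v i) • b i := by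
  conv_lhs => rw [← b.sum_repr v]
  rw [map_sum]
  exact Finset.sum_congr rfl fun i _ => by rw [hs.map_smul', hb]

omit [IsScalarTower F K V] in
theorem IsCoordinatewise.repr_map {τ : K →ₐ[F] K} {s : V →ₗ[F] V}
    (hs : IsCoordinatewise τ s) {b : Module.Basis (Fin 3) K V} (hb : ∀ i, s (b i) = b i) (v : V)
    (i : Fin 3) : b.repr (s v) i = τ (b.repr v i) := by
  rw [hs.map_eq_sum hb, b.repr_sum_self]

omit [IsScalarTower F K V] in
theorem IsCoordinatewise.map_map_map {τ : K →ₐ[F] K} {s : V →ₗ[F] V}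
    (hs : IsCoordinatewise τ s) (h3 : ∀ x, τ (τ (τ x)) = x) (v : V) : s (s (s v)) = v := by
  obtain ⟨b, hb⟩ := hs.exists_basis
  refine b.ext_elem fun i => ?_
  rw [hs.repr_map hb, hs.repr_map hb, hs.repr_map hb, h3]

variable [Finite F]

omit [IsScalarTower F K V] in
-- Additive Hilbert 90, applied to each coordinate.
theorem IsCoordinatewise.range_sub_id (hK : Module.finrank F K = 3) {τ : K →ₐ[F] K}
    (hτ : τ ≠ AlgHom.id F K) {s : V →ₗ[F] V} (hs : IsCoordinatewise τ s) {y : V}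
    (hy : y + s y + s (s y) = 0) : ∃ x, s x - x = y := by
  obtain ⟨b, hb⟩ := hs.exists_basis
  have hi : ∀ i, ∃ x : K, τ x - x = b.repr y i := fun i => by
    have : b.repr y i ∈ traceZero τ := by
      rw [mem_traceZero]
      have := congrArg (fun z => b.repr z i) hy
      simpa [hs.repr_map hb] using this
    rw [← (isLn_traceZero hK hτ).2] at this
    exact this
  choose x hx using hi
  refine ⟨∑ i, x i • b i, b.ext_elem fun i => ?_⟩
  rw [map_sub, Finsupp.sub_apply, hs.repr_map hb, b.repr_sum_self, hx]

omit [Finite F] in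
theorem IsCoordinatewise.finrank_ker_le (hK : Module.finrank F K = 3) {τ : K →ₐ[F] K}
    (hτ : τ ≠ AlgHom.id F K) {s : V →ₗ[F] V} (hs : IsCoordinatewise τ s) :
    Module.finrank F (LinearMap.ker (s - LinearMap.id)) ≤ 3 := by
  obtain ⟨b, hb⟩ := hs.exists_basis
  have hle : LinearMap.ker (s - LinearMap.id) ≤ Submodule.span F (Set.range b) := by
    intro x hx
    have hx' : s x = x := sub_eq_zero.1 hx
    rw [← b.sum_repr x]
    refine Submodule.sum_mem _ fun i _ => ?_
    obtain ⟨a, ha⟩ := mem_range_algebraMap_of_fixed hK hτ (x := b.repr x i) (by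
      rw [← hs.repr_map hb, hx'])
    rw [← ha, algebraMap_smul]
    exact Submodule.smul_mem _ _ (Submodule.subset_span (Set.mem_range_self i))
  have : FiniteDimensional F (Submodule.span F (Set.range b)) :=
    FiniteDimensional.span_of_finite F (Set.finite_range b)
  refine (Submodule.finrank_mono hle).trans ((finrank_range_le_card b).trans (by simp))

/-- Up to a scalar, `σ` is a coordinatewise action of order three, and the hwise-fixed 5-space
consists of the vectors of trace zero. -/
theorem exists_isCoordinatewise (hK : Module.finrank F K = 3) (hV : Module.finrank K V = 3)
    {φ : Submodule K V ≃o Submodule K V} (hφ : orderOf φ = 3) (hfix : FixesSubplane F φ)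
    {σ : V ≃ₗ[F] V} (hσ : Induces φ σ) {W : Submodule F V} (hW : IsHwiseFixed5Space σ W) :
    ∃ (τ : K →ₐ[F] K) (s : V →ₗ[F] V) (c : F), τ ≠ AlgHom.id F K ∧ c ≠ 0 ∧
      (∀ v, σ v = c • s v) ∧ IsCoordinatewise τ s ∧ ∀ y, y ∈ W ↔ y + s y + s (s y) = 0 := by
  have : FiniteDimensional F K := FiniteDimensional.of_finrank_pos (by omega)
  have : FiniteDimensional K V := FiniteDimensional.of_finrank_pos (by omega)
  have : FiniteDimensional F V := Module.Finite.trans K V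
  have hV9 : Module.finrank F V = 9 := by rw [← Module.finrank_mul_finrank F K V, hK, hV]
  have hφ1 : φ ≠ 1 := by rintro rfl; simp at hφ
  obtain ⟨b, τ, k, hτ, hk, hsemi, hb⟩ := hσ.exists_semilinear hφ1 hfix
  obtain ⟨c, hc⟩ := hW.exists_scalar hV9
  have hrange : LinearMap.range ((σ : V →ₗ[F] V) - c • LinearMap.id) ≤ W := by
    rintro _ ⟨v, rfl⟩; exact hc v
  have hrk := LinearMap.finrank_range_add_finrank_ker ((σ : V →ₗ[F] V) - c • LinearMap.id)
  have hW6 : Module.finrank F W = 6 := hW.1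
  have hle := Submodule.finrank_mono hrange
  -- The image of `σ - c` lies in `W`, of dimension 6 < 9, so `c` is an eigenvalue.
  obtain ⟨x, hx, hx0⟩ := Submodule.exists_mem_ne_zero_of_ne_bot
    (p := LinearMap.ker ((σ : V →ₗ[F] V) - c • LinearMap.id)) (fun h => by
      rw [h, finrank_bot] at hrk; omega)
  replace hx : σ x = c • x := sub_eq_zero.1 hx
  have hc0 : c ≠ 0 := by
    rintro rfl
    rw [zero_smul] at hx
    exact hx0 (σ.map_eq_zero_iff.1 hx)
  obtain ⟨i, hi⟩ : ∃ i, b.repr x i ≠ 0 := by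
    by_contra! h
    exact hx0 (b.repr.map_eq_zero_iff.1 (Finsupp.ext h))
  -- A nonzero coordinate `u` of the eigenvector satisfies `τ u * k = c u`, so each `u • b j` is an
  -- eigenvector for `c` and is fixed by `s = c⁻¹ σ`.
  have hu : τ (b.repr x i) * k = algebraMap F K c * b.repr x i := by
    have h1 : σ x = ∑ j, (τ (b.repr x j) * k) • b j := by
      conv_lhs => rw [← b.sum_repr x]
      rw [map_sum]
      exact Finset.sum_congr rfl fun j _ => by rw [hsemi, hb, smul_smul]
    have h2 := congrArg (fun z => b.repr z i) hx
    simp only [h1, b.repr_sum_self, ← algebraMap_smul K c, map_smul] at h2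
    exact h2
  let s : V →ₗ[F] V := c⁻¹ • (σ : V →ₗ[F] V)
  have hs : ∀ v, s v = c⁻¹ • σ v := fun v => rfl
  have hσs : ∀ v, σ v = c • s v := fun v => by rw [hs, smul_inv_smul₀ hc0]
  have hcw : IsCoordinatewise τ s := by
    refine ⟨fun l v => ?_, b.unitsSMul fun _ => Units.mk0 _ hi, fun j => ?_⟩
    · rw [hs, hs, hsemi, smul_comm]
    · rw [hs, b.unitsSMul_apply, Units.smul_mk0, hsemi, hb, smul_smul, hu, ← smul_smul,
        algebraMap_smul, inv_smul_smul₀ hc0]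
  refine ⟨τ, s, c, hτ, hc0, hσs, hcw, ?_⟩
  have hsW : ∀ v, s v - v ∈ W := fun v => by
    have : s v - v = c⁻¹ • (σ v - c • v) := by rw [smul_sub, inv_smul_smul₀ hc0, hs]
    rw [this]; exact W.smul_mem _ (hc v)
  have hrange' : LinearMap.range (s - LinearMap.id) ≤ W := by
    rintro _ ⟨v, rfl⟩; exact hsW v
  have hrk' := LinearMap.finrank_range_add_finrank_ker (s - LinearMap.id)
  have hker := hcw.finrank_ker_le hK hτ
  -- The rank of `s - 1` is at least 9 - 3 = 6, the dimension of `W`.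
  have hWeq := Submodule.eq_of_le_of_finrank_le hrange' (by omega)
  refine fun y => ⟨fun hy => ?_, fun hy => ?_⟩
  · rw [← hWeq] at hy
    obtain ⟨z, rfl⟩ := hy
    simp only [LinearMap.sub_apply, LinearMap.id_apply, map_sub,
      hcw.map_map_map (map_map_map_of_cubic hK τ)]
    abel
  · obtain ⟨z, rfl⟩ := hcw.range_sub_id hK hτ hy
    exact hsW z

omit [IsScalarTower F K V] in
/-- An `s`-invariant `K`-line is spanned by vectors fixed by `s`. -/
theorem IsCoordinatewise.exists_fixed_basis (hK : Module.finrank F K = 3) {τ : K →ₐ[F] K}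
    (hτ : τ ≠ AlgHom.id F K) {s : V →ₗ[F] V} (hs : IsCoordinatewise τ s) {m : Submodule K V}
    (hm : IsLn m) (hinv : ∀ x ∈ m, s x ∈ m) :
    ∃ v w : V, s v = v ∧ s w = w ∧ LinearIndependent K ![v, w] ∧
      m = Submodule.span K {v, w} := by
  have h3 := map_map_map_of_cubic hK τ
  obtain ⟨θ, hθ⟩ := exists_moved_element hτ h3
  have hmem : ∀ p : Submodule K V, (∀ v ∈ m, s v = v → v ∈ p) → m ≤ p := by
    intro p hp x hx
    -- Galois descent: the traces of `k • x` are fixed vectors, and those for `k = 1, θ, θ²`,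
    -- weighted by the coefficients of `(X - τ θ)(X - τ² θ)`, give a nonzero multiple of `x`.
    have hy : ∀ k : K, k • x + τ k • s x + τ (τ k) • s (s x) ∈ p := fun k => by
      refine hp _ ?_ ?_
      · exact m.add_mem (m.add_mem (m.smul_mem _ hx) (m.smul_mem _ (hinv x hx)))
          (m.smul_mem _ (hinv _ (hinv x hx)))
      · simp only [map_add, hs.map_smul', h3, hs.map_map_map h3]
        abel
    have key := p.add_mem (p.sub_mem (hy (θ ^ 2)) (p.smul_mem (τ θ + τ (τ θ)) (hy θ)))
      (p.smul_mem (τ θ * τ (τ θ)) (hy 1))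
    have e : θ ^ 2 • x + τ (θ ^ 2) • s x + τ (τ (θ ^ 2)) • s (s x) -
        (τ θ + τ (τ θ)) • (θ • x + τ θ • s x + τ (τ θ) • s (s x)) +
        (τ θ * τ (τ θ)) • ((1 : K) • x + τ 1 • s x + τ (τ 1) • s (s x)) =
        ((θ - τ θ) * (θ - τ (τ θ))) • x := by
      simp only [map_pow, map_one]
      module
    rw [e] at key
    exact (p.smul_mem_iff hθ).1 key
  have hm2 : Module.finrank K m = 2 := hm
  obtain ⟨v, hvm, hv, hv0⟩ : ∃ v ∈ m, s v = v ∧ v ≠ 0 := by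
    by_contra! h
    have := hmem ⊥ (fun v hv hsv => (Submodule.mem_bot K).2 (h v hv hsv))
    rw [le_bot_iff.1 this, finrank_bot] at hm2
    omega
  obtain ⟨w, hwm, hw, hwv⟩ : ∃ w ∈ m, s w = w ∧ w ∉ Submodule.span K {v} := by
    by_contra! h
    have := Submodule.finrank_mono (hmem _ h)
    rw [finrank_span_singleton hv0] at this
    omega
  have hli : LinearIndependent K ![v, w] := (LinearIndependent.pair_iff' hv0).2 fun a ha =>
    hwv (Submodule.mem_span_singleton.2 ⟨a, ha⟩)
  exact ⟨v, w, hv, hw, hli, hm.eq_span_pair hvm hwm hli⟩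

/-- The vectors of trace zero in an `s`-invariant `K`-line. -/
theorem IsCoordinatewise.exists_isOrderThreeBasis (hK : Module.finrank F K = 3) {τ : K →ₐ[F] K}
    (hτ : τ ≠ AlgHom.id F K) {s : V →ₗ[F] V} (hs : IsCoordinatewise τ s) {m : Submodule K V}
    (hm : IsLn m) (hinv : ∀ x ∈ m, s x ∈ m) {S : Submodule F V}
    (hS : ∀ x, x ∈ S ↔ x + s x + s (s x) = 0 ∧ x ∈ m) :
    ∃ (s' : S →ₗ[F] S) (b : Module.Basis (Fin 4) F S), (∀ x : S, (s' x : V) = s x) ∧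
      IsOrderThreeBasis s' b := by
  obtain ⟨v, w, hv, hw, hvw, hspan⟩ := hs.exists_fixed_basis hK hτ hm hinv
  obtain ⟨t, ht, htt, htr⟩ := exists_traceZero_basis hK hτ
  have h3 := map_map_map_of_cubic hK τ
  have hinvS : ∀ x ∈ S, s x ∈ S := fun x hx => by
    rw [hS] at hx ⊢
    refine ⟨?_, hinv x hx.2⟩
    rw [hs.map_map_map h3, ← hx.1]; abel
  have hvm : v ∈ m := hspan ▸ Submodule.subset_span (by simp)
  have hwm : w ∈ m := hspan ▸ Submodule.subset_span (by simp)
  have hmemS : ∀ k : K, k + τ k + τ (τ k) = 0 → ∀ z ∈ m, s z = z → k • z ∈ S := by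
    intro k hk z hz hsz
    rw [hS]
    refine ⟨?_, m.smul_mem _ hz⟩
    rw [hs.map_smul', hsz, hs.map_smul', hsz, ← add_smul, ← add_smul, hk, zero_smul]
  have ht' : τ t + τ (τ t) + τ (τ (τ t)) = 0 := by rw [h3]; linear_combination ht
  -- In this order `s` sends `e 0` to `e 2` and `e 1` to `e 3`; the other two images follow from `τ²
  -- t = -t - τ t`.
  let e : Fin 4 → S := ![⟨t • v, hmemS t ht v hvm hv⟩, ⟨t • w, hmemS t ht w hwm hw⟩,
    ⟨τ t • v, hmemS _ ht' v hvm hv⟩, ⟨τ t • w, hmemS _ ht' w hwm hw⟩]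
  have hli : LinearIndependent F e := by
    refine Fintype.linearIndependent_iff.2 fun g hg => ?_
    have hg' : (g 0 • t + g 2 • τ t) • v + (g 1 • t + g 3 • τ t) • w = 0 := by
      have := congrArg Subtype.val hg
      simp only [Fin.sum_univ_four, e] at this
      simp at this
      rw [← this]
      simp only [add_smul, smul_assoc]
      abel
    obtain ⟨h0, h1⟩ := LinearIndependent.pair_iff.1 hvw _ _ hg'
    obtain ⟨r0, r2⟩ := LinearIndependent.pair_iff.1 htt _ _ h0
    obtain ⟨r1, r3⟩ := LinearIndependent.pair_iff.1 htt _ _ h1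
    intro i; fin_cases i <;> assumption
  have hsp : ⊤ ≤ Submodule.span F (Set.range e) := by
    rintro ⟨x, hx⟩ -
    have hx' := (hS x).1 hx
    rw [hspan] at hx'
    obtain ⟨p, q, rfl⟩ := Submodule.mem_span_pair.1 hx'.2
    have h0 : (p + τ p + τ (τ p)) • v + (q + τ q + τ (τ q)) • w = 0 := by
      rw [← hx'.1]
      simp only [map_add, hs.map_smul', hv, hw]
      module
    obtain ⟨hp, hq⟩ := LinearIndependent.pair_iff.1 hvw _ _ h0
    obtain ⟨a, d, rfl⟩ := htr p hp
    obtain ⟨a', d', rfl⟩ := htr q hq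
    rw [Submodule.mem_span_range_iff_exists_fun]
    refine ⟨![a, a', d, d'], Subtype.ext ?_⟩
    simp [Fin.sum_univ_four, e]
    simp only [add_smul, smul_assoc]
    abel
  refine ⟨s.restrict hinvS, Module.Basis.mk hli hsp, fun x => rfl, ?_, ?_, ?_, ?_⟩ <;>
    refine Subtype.ext ?_ <;>
    simp [e, hs.map_smul', hv, hw]
  · rw [← neg_smul, ← sub_smul]; congr 1; linear_combination ht
  · rw [← neg_smul, ← sub_smul]; congr 1; linear_combination ht

end FieldReduction

/-! ### Fixed-I- and fixed-II-lines as invariant lines -/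

section FixedLines

variable {F K V : Type*} [Field F] [Field K] [Algebra F K] [AddCommGroup V] [Module F V]
  [Module K V] [IsScalarTower F K V]

theorem isFixed_iff {σ : V ≃ₗ[F] V} {X : Submodule F V} [FiniteDimensional F X] :
    IsFixed σ X ↔ ∀ x ∈ X, σ x ∈ X := by
  refine ⟨fun h x hx => ?_, fun h => ?_⟩
  · have : σ x ∈ X.map (σ : V →ₗ[F] V) := Submodule.mem_map_of_mem (f := (σ : V →ₗ[F] V)) hx
    rw [h] at this
    exact this
  · refine Submodule.eq_of_le_of_finrank_eq ?_ (LinearEquiv.finrank_map_eq σ X)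
    rintro _ ⟨x, hx, rfl⟩
    exact h x hx

theorem isFixed_span_singleton_iff {σ : V ≃ₗ[F] V} {x : V} :
    IsFixed σ (Submodule.span F {x}) ↔ ∃ μ : F, σ x = μ • x := by
  rw [isFixed_iff]
  refine ⟨fun h => ?_, fun ⟨μ, hμ⟩ y hy => ?_⟩
  · obtain ⟨μ, hμ⟩ := Submodule.mem_span_singleton.1 (h x (Submodule.mem_span_singleton_self x))
    exact ⟨μ, hμ.symm⟩
  · obtain ⟨a, rfl⟩ := Submodule.mem_span_singleton.1 hy
    rw [map_smul, hμ]
    exact Submodule.smul_mem _ _ (Submodule.smul_mem _ _ (Submodule.mem_span_singleton_self x))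

theorem isPtwiseFixedLine_iff {σ : V ≃ₗ[F] V} {ℓ : Submodule F V} :
    IsPtwiseFixedLine σ ℓ ↔ ℓ ∈ eigenLines (σ : V →ₗ[F] V) := by
  refine and_congr_right fun _ => ⟨fun h x hx => ?_, fun h P hP hPl => ?_⟩
  · by_cases hx0 : x = 0
    · exact ⟨0, by simp [hx0]⟩
    · exact isFixed_span_singleton_iff.1
        (h _ (isPt_span hx0) ((Submodule.span_singleton_le_iff_mem _ _).2 hx))
  · obtain ⟨x, -, rfl⟩ := hP.exists_eq_span
    exact isFixed_span_singleton_iff.2 (h x (hPl (Submodule.mem_span_singleton_self x)))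

theorem IsPt.eq_span_of_mem {Q : Submodule K V} (hQ : IsPt Q) {x : V} (hx : x ∈ Q)
    (hx0 : x ≠ 0) : Q = Submodule.span K {x} := by
  obtain ⟨y, hy0, rfl⟩ := hQ.exists_eq_span
  obtain ⟨a, rfl⟩ := Submodule.mem_span_singleton.1 hx
  refine (Submodule.span_singleton_smul_eq (IsUnit.mk0 a ?_) y).symm
  rintro rfl
  exact hx0 (zero_smul K y)

/-- In an `ℍ_I`-5-space the fixed-I-lines and fixed-II-lines are exactly the fixed lines that are
not fixed pointwise. -/
theorem isFixedILine_or_isFixedIILine_iff {φ : Submodule K V ≃o Submodule K V} {σ : V ≃ₗ[F] V}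
    (hσ : Induces φ σ) {H : Submodule F V} (hH : IsHI5Space φ H) {ℓ : Submodule F V}
    (hℓH : ℓ ≤ H) :
    IsFixedILine φ σ ℓ ∨ IsFixedIILine φ σ ℓ ↔ ℓ ∈ movedLines (σ : V →ₗ[F] V) := by
  constructor
  · rintro (⟨hℓ, hfix, ⟨P, hPl, hP, -, hPfix, -⟩, -⟩ | ⟨hℓ, hfix, ⟨P, hPl, hP, hA, -⟩, -⟩)
    · have := hℓ.finiteDimensional
      obtain ⟨x, -, rfl⟩ := hP.exists_eq_span
      refine ⟨hℓ, isFixed_iff.1 hfix, x, hPl (Submodule.mem_span_singleton_self x),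
        fun μ hμ => hPfix (isFixed_span_singleton_iff.2 ⟨μ, hμ⟩)⟩
    · have := hℓ.finiteDimensional
      obtain ⟨x, hx0, rfl⟩ := hP.exists_eq_span
      obtain ⟨_, ⟨Q, ⟨hQ, hne, -⟩, rfl⟩, hPQ⟩ := hA
      refine ⟨hℓ, isFixed_iff.1 hfix, x, hPl (Submodule.mem_span_singleton_self x),
        fun μ hμ => hne ?_⟩
      have hxQ : x ∈ Q := hPQ (Submodule.mem_span_singleton_self x)
      replace hμ : σ x = μ • x := hμ
      have hσx : σ x ∈ Q := by
        rw [hμ, ← algebraMap_smul K μ x]; exact Q.smul_mem _ hxQ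
      have hσ0 : σ x ≠ 0 := fun h => hx0 (σ.map_eq_zero_iff.1 h)
      -- A point fixed by `σ` spans a point fixed by `φ`, so it is on no `𝕊_II`-plane.
      conv_lhs => rw [hQ.eq_span_of_mem hxQ hx0]
      rw [hσ.map_span_singleton, ← hQ.eq_span_of_mem hσx hσ0]
  · rintro ⟨hℓ, hinv, x, hx, hne⟩
    have := hℓ.finiteDimensional
    have hfix : IsFixed σ ℓ := isFixed_iff.2 hinv
    have hmap : ∀ {P : Submodule F V}, P ≤ ℓ → P.map (σ : V →ₗ[F] V) ≤ ℓ := fun hP =>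
      (Submodule.map_mono hP).trans (le_of_eq hfix)
    have hcol : ∀ P ≤ ℓ, HasCollinearOrbit σ P := fun P hP =>
      ⟨ℓ, hℓ, hP, hmap hP, hmap (hmap hP)⟩
    have hle : ∀ {y}, y ∈ ℓ → Submodule.span F {y} ≤ ℓ := fun hy =>
      (Submodule.span_singleton_le_iff_mem _ _).2 hy
    -- If a moved vector `x` of `ℓ` spans a Type I point, that `𝕊_I`-plane contains `ℓ = ⟨x, σ x⟩`.
    -- Otherwise every moved vector spans a Type II point, its `φ`-orbit staying on the fixed line
    -- `m`.
    by_cases hI : ∃ x ∈ ℓ, (∀ μ : F, σ x ≠ μ • x) ∧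
        φ (Submodule.span K {x}) = Submodule.span K {x}
    · obtain ⟨x, hx, hne, hφx⟩ := hI
      have hx0 : x ≠ 0 := by rintro rfl; exact hne 0 (by simp)
      have hA : IsSIPlane φ ((Submodule.span K {x}).restrictScalars F) :=
        ⟨_, ⟨isPt_span hx0, hφx⟩, rfl⟩
      have hℓA : ℓ ≤ (Submodule.span K {x}).restrictScalars F := by
        rw [eq_span_of_moved (s := (σ : V →ₗ[F] V)) hℓ hne hx (hinv x hx), Submodule.span_le]
        rintro z (rfl | rfl)
        · exact Submodule.mem_span_singleton_self z
        · have := hσ.map_mem (Submodule.mem_span_singleton_self (R := K) x)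
          rw [hφx] at this
          exact this
      have hcolon : ∀ P, IsPt P → P ≤ ℓ → ¬ IsFixed σ P → IsIColonPoint φ σ P :=
        fun P hP hPl hPf => ⟨hP, ⟨_, hA, hPl.trans hℓA⟩, hPf, hcol P hPl⟩
      refine .inl ⟨hℓ, hfix, ⟨_, hle hx, hcolon _ (isPt_span hx0) (hle hx) fun h => ?_⟩,
        fun P hP hPl => or_iff_not_imp_left.2 (hcolon P hP hPl), _, hA, hℓA⟩
      obtain ⟨μ, hμ⟩ := isFixed_span_singleton_iff.1 h
      exact hne μ hμ
    · push Not at hI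
      have hcolon : ∀ y ∈ ℓ, (∀ μ : F, σ y ≠ μ • y) →
          IsIIColonPoint φ σ (Submodule.span F {y}) := by
        intro y hy hyne
        have hy0 : y ≠ 0 := by rintro rfl; exact hyne 0 (by simp)
        obtain ⟨m, hm, hφm, rfl⟩ := hH
        have hym : y ∈ m := hℓH hy
        have h1 : Submodule.span K {y} ≤ m := (Submodule.span_singleton_le_iff_mem _ _).2 hym
        have h2 : φ (Submodule.span K {y}) ≤ m := hφm ▸ φ.monotone h1
        have h3 : φ (φ (Submodule.span K {y})) ≤ m := hφm ▸ φ.monotone h2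
        refine ⟨isPt_span hy0, ⟨_, ⟨Submodule.span K {y}, ⟨isPt_span hy0, hI y hy hyne, m, hm, h1,
          h2, h3⟩, rfl⟩, ?_⟩, hcol _ (hle hy)⟩
        rw [Submodule.span_singleton_le_iff_mem]
        exact Submodule.mem_span_singleton_self y
      refine .inr ⟨hℓ, hfix, ⟨_, hle hx, hcolon x hx hne⟩, fun P hP hPl => ?_, H, hH, hℓH⟩
      obtain ⟨y, -, rfl⟩ := hP.exists_eq_span
      refine or_iff_not_imp_left.2 fun h => hcolon y (hPl (Submodule.mem_span_singleton_self y)) ?_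
      exact fun μ hμ => h (isFixed_span_singleton_iff.2 ⟨μ, hμ⟩)

section Restriction

variable {σ : V →ₗ[F] V} {S : Submodule F V} {s : S →ₗ[F] S} {c : F}

theorem isLn_map_subtype_iff {ℓ : Submodule F S} : IsLn (ℓ.map S.subtype) ↔ IsLn ℓ := by
  rw [IsLn, IsLn, Submodule.finrank_map_subtype_eq]

theorem map_subtype_mem_eigenLines_iff (hc : c ≠ 0) (hs : ∀ x : S, σ x = c • (s x : V))
    {ℓ : Submodule F S} : ℓ.map S.subtype ∈ eigenLines σ ↔ ℓ ∈ eigenLines s := by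
  refine and_congr isLn_map_subtype_iff ⟨fun h x hx => ?_, ?_⟩
  · obtain ⟨μ, hμ⟩ := h x (Submodule.mem_map_of_mem (f := S.subtype) hx)
    refine ⟨c⁻¹ * μ, Subtype.ext ?_⟩
    rw [Submodule.coe_smul, mul_smul, ← hμ, hs, inv_smul_smul₀ hc]
  · rintro h _ ⟨x, hx, rfl⟩
    obtain ⟨μ, hμ⟩ := h x hx
    refine ⟨c * μ, ?_⟩
    rw [Submodule.subtype_apply, hs, hμ, Submodule.coe_smul, mul_smul]

theorem map_subtype_mem_movedLines_iff (hc : c ≠ 0) (hs : ∀ x : S, σ x = c • (s x : V))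
    {ℓ : Submodule F S} : ℓ.map S.subtype ∈ movedLines σ ↔ ℓ ∈ movedLines s := by
  have hmem : ∀ x : S, σ x ∈ ℓ.map S.subtype ↔ s x ∈ ℓ := fun x => by
    rw [hs, Submodule.smul_mem_iff _ hc]
    exact S.subtype_injective.mem_set_image (s := (ℓ : Set S))
  refine and_congr isLn_map_subtype_iff (and_congr ⟨fun h x hx => ?_, ?_⟩ ⟨?_, ?_⟩)
  · exact (hmem x).1 (h x (Submodule.mem_map_of_mem (f := S.subtype) hx))
  · rintro h _ ⟨x, hx, rfl⟩
    exact (hmem x).2 (h x hx)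
  · rintro ⟨_, ⟨x, hx, rfl⟩, hne⟩
    refine ⟨x, hx, fun μ hμ => hne (c * μ) ?_⟩
    rw [Submodule.subtype_apply, hs, hμ, Submodule.coe_smul, mul_smul]
  · rintro ⟨x, hx, hne⟩
    refine ⟨x, Submodule.mem_map_of_mem (f := S.subtype) hx, fun μ hμ => hne (c⁻¹ * μ) ?_⟩
    rw [hs] at hμ
    refine Subtype.ext ?_
    rw [Submodule.coe_smul, mul_smul, ← hμ, inv_smul_smul₀ hc]

end Restriction

end FixedLines

/-! ### Roots of `X² + X + 1` and the residue of `q` modulo 3 -/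

section CubeRoots

variable {F : Type*} [Field F] [Finite F]

theorem three_eq_zero_of_card_mod (h : Nat.card F % 3 = 0) : (3 : F) = 0 := by
  have := Fintype.ofFinite F
  obtain ⟨p, hp, n, hprime, hcard⟩ := FiniteField.card' F
  rw [Nat.card_eq_fintype_card, hcard] at h
  have h3 : 3 = p := (Nat.prime_dvd_prime_iff_eq Nat.prime_three hprime).1
    (Nat.prime_three.dvd_of_dvd_pow (Nat.dvd_of_mod_eq_zero h))
  subst h3
  exact_mod_cast CharP.cast_eq_zero F 3

theorem three_ne_zero_of_card_mod (h : Nat.card F % 3 ≠ 0) : (3 : F) ≠ 0 := fun h3 => by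
  have := Fintype.ofFinite F
  have hq : ((Nat.card F : ℕ) : F) = 0 := by
    rw [Nat.card_eq_fintype_card]; exact FiniteField.cast_card_eq_zero F
  rw [← Nat.div_add_mod (Nat.card F) 3, Nat.cast_add, Nat.cast_mul, Nat.cast_ofNat, h3, zero_mul,
    zero_add] at hq
  have : Nat.card F % 3 = 1 ∨ Nat.card F % 3 = 2 := by omega
  rcases this with h | h
  · rw [h, Nat.cast_one] at hq
    exact one_ne_zero hq
  · rw [h, Nat.cast_ofNat] at hq
    exact one_ne_zero (α := F) (by linear_combination h3 - hq)

theorem exists_root_of_card_mod (h : Nat.card F % 3 = 1) : ∃ μ : F, μ ^ 2 + μ + 1 = 0 := by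
  have : Fact (Nat.Prime 3) := ⟨Nat.prime_three⟩
  obtain ⟨g, hg⟩ := exists_prime_orderOf_dvd_card' (G := Fˣ) 3 (by rw [Nat.card_units]; omega)
  refine ⟨g, ?_⟩
  have h1 : (g : F) ≠ 1 := fun h1 => by
    rw [Units.val_eq_one.1 h1, orderOf_one] at hg
    omega
  have h3 : (g : F) ^ 3 = 1 := by
    rw [← Units.val_pow_eq_pow_val, ← hg, pow_orderOf_eq_one, Units.val_one]
  refine (mul_eq_zero.1 ?_).resolve_left (sub_ne_zero.2 h1)
  linear_combination h3

/-- As `3 ≠ 0`, a root differs from `1` and has order three, which does not divide `q - 1`. -/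
theorem no_root_of_card_mod (h : Nat.card F % 3 = 2) (μ : F) : μ ^ 2 + μ + 1 ≠ 0 := fun hμ => by
  have h3 : (3 : F) ≠ 0 := three_ne_zero_of_card_mod (by omega)
  have h0 : μ ≠ 0 := by rintro rfl; simp at hμ
  have : Fact (Nat.Prime 3) := ⟨Nat.prime_three⟩
  have hord : orderOf (Units.mk0 μ h0) = 3 := by
    refine orderOf_eq_prime (Units.ext ?_) fun h1 => h3 ?_
    · push_cast
      simp only [Units.val_mk0]
      linear_combination (μ - 1) * hμ
    · have : μ = 1 := congrArg Units.val h1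
      subst this
      linear_combination hμ
  have := orderOf_dvd_natCard (Units.mk0 μ h0)
  rw [hord, Nat.card_units] at this
  omega

end CubeRoots

theorem theorem15 {F K V : Type*} [Field F] [Finite F] [Field K] [Algebra F K]
    [AddCommGroup V] [Module F V] [Module K V] [IsScalarTower F K V]
    (hq : 2 < Nat.card F) (hK : Module.finrank F K = 3) (hV : Module.finrank K V = 3)
    (φ : Submodule K V ≃o Submodule K V) (hφ : orderOf φ = 3) (hfix : FixesSubplane F φ)
    (σ : V ≃ₗ[F] V) (hσ : Induces φ σ)
    (W : Submodule F V) (hW : IsHwiseFixed5Space σ W)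
    (H : Submodule F V) (hH : IsHI5Space φ H)
    (S : Submodule F V) (hS : S = W ⊓ H) :
    Module.finrank F S = 4 ∧
    (Nat.card F % 3 = 2 → IsEllipticCongruence (fixedLinesIn φ σ S)) ∧
    (Nat.card F % 3 = 0 → ∃ ℓ : Submodule F S, ptwiseFixedLinesIn σ S = {ℓ} ∧
      IsParabolicCongruence (insert ℓ (fixedLinesIn φ σ S)) ℓ) ∧
    (Nat.card F % 3 = 1 → ∃ ℓ₁ ℓ₂ : Submodule F S, ℓ₁ ≠ ℓ₂ ∧
      ptwiseFixedLinesIn σ S = {ℓ₁, ℓ₂} ∧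
      IsHyperbolicCongruence (fixedLinesIn φ σ S) ℓ₁ ℓ₂) := by
  have : FiniteDimensional F K := FiniteDimensional.of_finrank_pos (by omega)
  obtain ⟨τ, s, c, hτ, hc, hσs, hs, hWs⟩ := exists_isCoordinatewise hK hV hφ hfix hσ hW
  have hH' := hH
  obtain ⟨m, hm, hφm, rfl⟩ := hH'
  have hinv : ∀ x ∈ m, s x ∈ m := fun x hx => by
    have h1 := hσ.map_mem hx
    rw [hφm, hσs, ← algebraMap_smul K c] at h1
    exact (m.smul_mem_iff ((map_ne_zero _).2 hc)).1 h1
  obtain ⟨s', b, hs', hb⟩ := hs.exists_isOrderThreeBasis hK hτ hm hinv (S := S) fun x => by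
    rw [hS, Submodule.mem_inf, hWs]; rfl
  have hσ' : ∀ x : S, (σ : V →ₗ[F] V) x = c • (s' x : V) := fun x => by
    rw [hs']; exact hσs x
  have hfixed : fixedLinesIn φ σ S = movedLines s' := Set.ext fun ℓ =>
    (isFixedILine_or_isFixedIILine_iff hσ hH
      ((Submodule.map_subtype_le S ℓ).trans (hS ▸ inf_le_right))).trans
      (map_subtype_mem_movedLines_iff hc hσ')
  have hptwise : ptwiseFixedLinesIn σ S = eigenLines s' := Set.ext fun ℓ =>
    isPtwiseFixedLine_iff.trans (map_subtype_mem_eigenLines_iff hc hσ')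
  rw [hfixed, hptwise]
  refine ⟨by simpa using Module.finrank_eq_card_basis b, fun h => ?_, fun h => ?_, fun h => ?_⟩
  · exact hb.isEllipticCongruence (no_root_of_card_mod h)
  · exact hb.exists_isParabolicCongruence (three_eq_zero_of_card_mod h)
  · obtain ⟨μ, hμ⟩ := exists_root_of_card_mod h
    exact hb.exists_isHyperbolicCongruence (three_ne_zero_of_card_mod (by omega)) hμ
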